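/- Let $k\ge 1$. All graphs are finite and simple. A $k$-tree is defined recursively: $K_k$ is a $k$-tree, and if $T$ is a $k$-tree, then so is the graph obtained from $T$ by adding a new vertex adjacent to exactly the vertices of some $k$-clique of $T$. A sub-$k$-tree of $T$ is a subgraph of $T$ that is itself a $k$-tree. A $k$-clique is a complete subgraph on $k$ vertices; for a $k$-clique $C$ of $T$, let $a_i(T;C)$ be the number of sub-$k$-trees of $T$ of order $i$ that contain $C$, let $\phi_{T,C}(x)=\sum_{i=k}^{|V(T)|}a_i(T;C)x^i$, and let $\mu(T;C)=\phi_{T,C}'(1)/\phi_{T,C}(1)$, the mean order of the sub-$k$-trees of $T$ containing $C$. The degree of a $k$-clique of $T$ is the number of $(k+1)$-cliques of $T$ containing it; an end $k$-clique is a $k$-clique of degree $1$. Two distinct $k$-cliques are adjacent if they are contained in a common $(k+1)$-clique of $T$. A $k$-leaf is a vertex of degree $k$ in a $k$-tree of order at least $k+1$, and a $k$-clique containing a $k$-leaf is called simplicial. The path-type $k$-trees are defined recursively: $K_k$ and $K_{k+1}$ are path-type $k$-trees, and if $P$ is a path-type $k$-tree of order at least $k+1$, then so is the graph obtained from $P$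 by joining a new vertex to exactly the vertices of some simplicial $k$-clique of $P$. **Proposition.** Let $C_1$ be an end $k$-clique of a $k$-tree $T$, and let $C_2$ be a $k$-clique of $T$ adjacent to $C_1$. Then $$\mu(T;C_1)\ge \mu(T;C_2),$$ with equality if and only if either $C_2$ is an end $k$-clique, or $T$ is a path-type $k$-tree and $C_1$ contains a $k$-leaf of $T$. -/

import Mathlib

universe u

namespace KTree

/-- `IsKTree k G`: the graph `G` is a `k`-tree. The definition is up to isomorphism: either `G` is a
complete graph on `k` vertices, or `G` has a vertex `v` such that `G - v` is a `k`-tree and `v` is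
joined to exactly the vertices of some `k`-clique `C` of `G - v`. -/
inductive IsKTree (k : ℕ) : ∀ {V : Type u}, SimpleGraph V → Prop
  | complete {V : Type u} (G : SimpleGraph V) (hcard : Nat.card V = k) (hG : G = ⊤) : IsKTree k G
  | addVertex {V : Type u} (G : SimpleGraph V) (v : V) (C : Finset ({v}ᶜ : Set V))
      (hT : IsKTree k (G.induce ({v}ᶜ : Set V)))
      (hC : (G.induce ({v}ᶜ : Set V)).IsNClique k C)
      (hv : ∀ w : ({v}ᶜ : Set V), G.Adj v w ↔ w ∈ C) : IsKTree k G

/-- A `k`-leaf: a vertex of degree `k` (such a vertex exists only if the order is at least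
`k + 1`). -/
def IsKLeaf {V : Type u} (k : ℕ) (G : SimpleGraph V) (v : V) : Prop :=
  (G.neighborSet v).ncard = k

/-- A simplicial `k`-clique: a `k`-clique containing a `k`-leaf. -/
def IsSimplicialClique {V : Type u} (k : ℕ) (G : SimpleGraph V) (C : Finset V) : Prop :=
  G.IsNClique k C ∧ ∃ v ∈ C, IsKLeaf k G v

/-- Path-type `k`-trees, up to isomorphism: `K_k`, `K_{k+1}`, and every graph obtained from a
path-type `k`-tree `G - v` of order at least `k + 1` by joining a new vertex `v` to exactly the
vertices of a simplicial `k`-clique of `G - v`. -/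
inductive IsPathTypeKTree (k : ℕ) : ∀ {V : Type u}, SimpleGraph V → Prop
  | complete {V : Type u} (G : SimpleGraph V) (hcard : Nat.card V = k) (hG : G = ⊤) :
      IsPathTypeKTree k G
  | complete_succ {V : Type u} (G : SimpleGraph V) (hcard : Nat.card V = k + 1) (hG : G = ⊤) :
      IsPathTypeKTree k G
  | addVertex {V : Type u} (G : SimpleGraph V) (v : V) (C : Finset ({v}ᶜ : Set V))
      (hP : IsPathTypeKTree k (G.induce ({v}ᶜ : Set V)))
      (horder : k + 1 ≤ Nat.card ({v}ᶜ : Set V))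
      (hC : IsSimplicialClique k (G.induce ({v}ᶜ : Set V)) C)
      (hv : ∀ w : ({v}ᶜ : Set V), G.Adj v w ↔ w ∈ C) : IsPathTypeKTree k G

/-- The degree of a `k`-clique `C`: the number of `(k+1)`-cliques containing `C`. -/
noncomputable def cliqueDegree {V : Type u} (k : ℕ) (G : SimpleGraph V) (C : Finset V) : ℕ :=
  {Q : Finset V | G.IsNClique (k + 1) Q ∧ C ⊆ Q}.ncard

/-- An end `k`-clique: a `k`-clique of degree `1`. -/
def IsEndClique {V : Type u} (k : ℕ) (G : SimpleGraph V) (C : Finset V) : Prop :=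
  G.IsNClique k C ∧ cliqueDegree k G C = 1

/-- Two (distinct) `k`-cliques are adjacent if they are contained in a common `(k+1)`-clique. -/
def AdjacentCliques {V : Type u} (k : ℕ) (G : SimpleGraph V) (C D : Finset V) : Prop :=
  G.IsNClique k C ∧ G.IsNClique k D ∧ C ≠ D ∧
    ∃ Q : Finset V, G.IsNClique (k + 1) Q ∧ C ⊆ Q ∧ D ⊆ Q

/-- A sub-`k`-tree: a (not necessarily induced) subgraph that is itself a `k`-tree. -/
def IsSubKTree {V : Type u} (k : ℕ) {G : SimpleGraph V} (H : G.Subgraph) : Prop :=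
  IsKTree k H.coe

/-- `a_i(G; S)`: the number of sub-`k`-trees of order `i` in `G` containing `S`. -/
noncomputable def numSubKTrees {V : Type u} (k : ℕ) {G : SimpleGraph V} (S : G.Subgraph)
    (i : ℕ) : ℕ :=
  {H : G.Subgraph | IsSubKTree k H ∧ S ≤ H ∧ H.verts.ncard = i}.ncard

/-- The local sub-`k`-tree polynomial of `G` at `S`. -/
noncomputable def localPolynomial {V : Type u} (k : ℕ) {G : SimpleGraph V} (S : G.Subgraph) :
    Polynomial ℝ :=
  ∑ i ∈ Finset.Icc S.verts.ncard (Nat.card V),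
    Polynomial.C (numSubKTrees k S i : ℝ) * Polynomial.X ^ i

/-- The local mean order `μ(G; S) = φ'(1) / φ(1)` of the sub-`k`-trees of `G` containing `S`. -/
noncomputable def localMeanOrder {V : Type u} (k : ℕ) {G : SimpleGraph V} (S : G.Subgraph) : ℝ :=
  (localPolynomial k S).derivative.eval 1 / (localPolynomial k S).eval 1

/-- The local mean order `μ(G; C)` at a `k`-clique `C`, regarded as the complete subgraph of `G`
on the vertex set `C`. -/
noncomputable def cliqueMeanOrder {V : Type u} (k : ℕ) (G : SimpleGraph V) (C : Finset V) : ℝ :=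
  localMeanOrder k ((⊤ : G.Subgraph).induce (C : Set V))

end KTree

/-! Sub-`k`-trees are induced, so they correspond to vertex sets, and regrowing from any `k`-clique
lets every set containing `C` be grown from `C`. Write `C = C₂` and let `u` be the vertex of `C₁`
outside `C`. Since `C₁` is an end clique, every sub-`k`-tree containing it, other than `C₁` itself,
contains `insert u C`. So both families share the sets through `C` and `u`; to these, `C₁` adds only
itself and `C₂` adds the sets avoiding `u`.

The clique `C` separates the branch of `u` from the rest, so a set through `u` is a free union,
along `C`, of a set avoiding `u` and a set inside the branch (`IsBranch.sum_throughSets`). Measure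
orders by their offset from `k`. With `a` avoiding sets of total offset `s` and `c` branch sets of
total offset `t`, the two means are `k + (c s + a t)/(1 + a c)` and `k + (s + c s + a t)/(a + a c)`.
Cross-multiplying reduces the comparison to `(c + 1) s ≤ a (a - 1) t`. This follows from `c ≤ t` and
from `2 s ≤ a (a - 1)`, the latter because the offsets of the avoiding sets have no gaps
(`two_mul_sum_le`).

Equality means `a = 1`, or `c = t = 1` with avoiding sets of distinct orders. The first says that
`C₂` is an end clique. Otherwise the second says that `C₁` lies in at most one sub-`k`-tree of each
order, which `Grown.pathGrown` and `PathGrown.injOn_card` match with path-type trees having a leaf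
in `C₁`. -/

namespace KTree

/-! ### Growing vertex sets from a clique; separation by a clique -/

section Growth

open scoped Classical

variable {V : Type u} {k : ℕ} {T : SimpleGraph V}

/-- The neighbours of `v` inside the finite set `S`. -/
noncomputable def nbrIn (T : SimpleGraph V) (v : V) (S : Finset V) : Finset V :=
  S.filter (T.Adj v)

@[simp] lemma mem_nbrIn {v x : V} {S : Finset V} : x ∈ nbrIn T v S ↔ x ∈ S ∧ T.Adj v x := by
  simp [nbrIn]

lemma nbrIn_subset (v : V) (S : Finset V) : nbrIn T v S ⊆ S := Finset.filter_subset _ _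

/-- `Grown k T C S`: the set `S` arises from `C` by successively adding vertices whose neighbours
among the vertices already present form a `k`-clique. -/
inductive Grown (k : ℕ) (T : SimpleGraph V) (C : Finset V) : Finset V → Prop
  | refl : Grown k T C C
  | step {S : Finset V} {v : V} (h : Grown k T C S) (hv : v ∉ S)
      (hK : T.IsNClique k (nbrIn T v S)) : Grown k T C (insert v S)

lemma Grown.subset {C S : Finset V} (h : Grown k T C S) : C ⊆ S := by
  induction h with
  | refl => exact subset_rfl
  | step _ _ _ ih => exact ih.trans (Finset.subset_insert _ _)

lemma isNClique_eq_of_subset {C D : Finset V} (hC : T.IsNClique k C) (hD : T.IsNClique k D)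
    (h : C ⊆ D) : C = D :=
  Finset.eq_of_subset_of_card_le h (by rw [hC.card_eq, hD.card_eq])

lemma nbrIn_insert_of_not_adj {v x : V} {S : Finset V} (h : ¬ T.Adj v x) :
    nbrIn T v (insert x S) = nbrIn T v S := by
  ext y
  simp only [mem_nbrIn, Finset.mem_insert]
  constructor
  · rintro ⟨rfl | hy, hv⟩
    · exact absurd hv h
    · exact ⟨hy, hv⟩
  · rintro ⟨hy, hv⟩
    exact ⟨Or.inr hy, hv⟩

lemma isNClique_insert_nbrIn {v : V} {S : Finset V} (hK : T.IsNClique k (nbrIn T v S)) :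
    T.IsNClique (k + 1) (insert v (nbrIn T v S)) :=
  hK.insert fun _ hb => (mem_nbrIn.1 hb).2

lemma isNClique_succ_insert_iff {C : Finset V} {u : V} (hC : T.IsNClique k C) (hu : u ∉ C) :
    T.IsNClique (k + 1) (insert u C) ↔ ∀ c ∈ C, T.Adj u c := by
  constructor
  · intro h c hc
    exact h.isClique (by simp) (by simp [hc]) (by rintro rfl; exact hu hc)
  · exact fun h => hC.insert h

lemma exists_insert_of_isNClique_subset {C Q : Finset V} (hC : T.IsNClique k C)
    (hQ : T.IsNClique (k + 1) Q) (h : C ⊆ Q) :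
    ∃ u, u ∉ C ∧ Q = insert u C ∧ ∀ c ∈ C, T.Adj u c := by
  have h1 : (Q \ C).card = 1 := by
    rw [Finset.card_sdiff_of_subset h, hC.card_eq, hQ.card_eq]; omega
  obtain ⟨u, hu⟩ := Finset.card_eq_one.1 h1
  have huQ : u ∈ Q \ C := by rw [hu]; simp
  have huC := (Finset.mem_sdiff.1 huQ).2
  have hQe : Q = insert u C := by
    rw [← Finset.sdiff_union_of_subset h, hu]; rfl
  exact ⟨u, huC, hQe, (isNClique_succ_insert_iff hC huC).1 (hQe ▸ hQ)⟩

lemma nbrIn_eq_self {v : V} {C : Finset V} (h : ∀ c ∈ C, T.Adj v c) : nbrIn T v C = C := by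
  ext y; simp only [mem_nbrIn]; exact ⟨fun h => h.1, fun hy => ⟨hy, h y hy⟩⟩

/-- The last vertex `v` can be moved to the front: it is adjacent only to `D`, so it commutes with
every vertex added after `D`. Then `C` is another facet of the `(k+1)`-clique `insert v D`, and
growth can start there. -/
lemma Grown.of_insert {D X C : Finset V} {v : V} (hD : T.IsNClique k D) (hX : Grown k T D X)
    (hv : v ∉ X) (hN : nbrIn T v X = D) (hC : T.IsNClique k C) (hCD : C ⊆ insert v D)
    (hvC : v ∈ C) : Grown k T C (insert v X) := by
  induction hX with
  | refl =>
    have hQ : T.IsNClique (k + 1) (insert v D) := by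
      have := isNClique_insert_nbrIn (hN.symm ▸ hD : T.IsNClique k (nbrIn T v D))
      rwa [hN] at this
    obtain ⟨w, hw, hQe, hadj⟩ := exists_insert_of_isNClique_subset hC hQ hCD
    rw [hQe]
    exact Grown.refl.step hw (by rwa [nbrIn_eq_self hadj])
  | @step Y y hY hy hK ih =>
    have hyD : y ∉ D := fun h => hy (hY.subset h)
    have hvy : ¬ T.Adj v y := fun h => hyD (by rw [← hN]; simp [h])
    rw [nbrIn_insert_of_not_adj hvy] at hN
    have hvY : v ∉ Y := fun h => hv (Finset.mem_insert_of_mem h)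
    have hyv : y ≠ v := by rintro rfl; simp at hv
    rw [Finset.insert_comm]
    refine (ih hvY hN).step (by simp [hyv, hy]) ?_
    rwa [nbrIn_insert_of_not_adj (fun h => hvy h.symm)]

/-- A `k`-tree can be grown from each of its `k`-cliques. -/
lemma Grown.regrow {C₀ S C : Finset V} (h : Grown k T C₀ S) (hC₀ : T.IsNClique k C₀)
    (hC : T.IsNClique k C) (hCS : C ⊆ S) : Grown k T C S := by
  induction h generalizing C with
  | refl => rw [isNClique_eq_of_subset hC hC₀ hCS]; exact Grown.refl
  | @step S v hS hv hK ih =>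
    by_cases hvC : v ∈ C
    · refine Grown.of_insert hK (ih hK (nbrIn_subset _ _)) hv rfl hC ?_ hvC
      intro x hx
      rcases eq_or_ne x v with rfl | hxv
      · simp
      · have : T.Adj v x := hC.isClique hvC hx hxv.symm
        simp [this, (Finset.mem_insert.1 (hCS hx)).resolve_left hxv]
    · refine (ih hC fun x hx => ?_).step hv hK
      exact (Finset.mem_insert.1 (hCS hx)).resolve_left (by rintro rfl; exact hvC hx)

lemma Grown.card_ge {C S : Finset V} (h : Grown k T C S) (hC : T.IsNClique k C) : k ≤ S.card :=
  hC.card_eq ▸ Finset.card_le_card h.subset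

lemma Grown.exists_card_eq {C S : Finset V} (h : Grown k T C S) (hC : T.IsNClique k C) {i : ℕ}
    (hi : k ≤ i) (hiS : i ≤ S.card) : ∃ S' ⊆ S, Grown k T C S' ∧ S'.card = i := by
  induction h with
  | refl => exact ⟨C, subset_rfl, Grown.refl, le_antisymm (hC.card_eq ▸ hi) hiS⟩
  | @step S v hS hv hK ih =>
    rcases Nat.lt_or_ge S.card i with h | h
    · refine ⟨insert v S, subset_rfl, hS.step hv hK, ?_⟩
      rw [Finset.card_insert_of_notMem hv] at hiS ⊢
      omega
    · obtain ⟨S', h1, h2, h3⟩ := ih h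
      exact ⟨S', h1.trans (Finset.subset_insert _ _), h2, h3⟩

lemma Grown.exists_first {C S : Finset V} (h : Grown k T C S) (hC : T.IsNClique k C)
    (hne : S ≠ C) : ∃ v ∈ S, v ∉ C ∧ ∀ c ∈ C, T.Adj v c := by
  induction h with
  | refl => exact absurd rfl hne
  | @step S v hS hv hK ih =>
    by_cases hSC : S = C
    · subst hSC
      refine ⟨v, by simp, hv, fun c hc => ?_⟩
      rw [← isNClique_eq_of_subset hK hC (nbrIn_subset _ _)] at hc
      exact (mem_nbrIn.1 hc).2
    · obtain ⟨w, h1, h2⟩ := ih hSC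
      exact ⟨w, by simp [h1], h2⟩

/-- The map `r` labels the components of `S` outside `C`. It fixes vertices joined to all of `C`, so
no component has two of them. -/
lemma Grown.exists_root {C S : Finset V} (h : Grown k T C S) (hC : T.IsNClique k C) :
    ∃ r : V → V, (∀ x ∈ S, ∀ y ∈ S, x ∉ C → y ∉ C → T.Adj x y → r x = r y) ∧
      ∀ x ∈ S, x ∉ C → (∀ c ∈ C, T.Adj x c) → r x = x := by
  induction h with
  | refl => exact ⟨id, fun x hx _ _ h => absurd hx h, fun x hx h => absurd hx h⟩
  | @step S v hS hv hK ih =>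
    obtain ⟨r, hr, hroot⟩ := ih
    obtain ⟨t, ht, htC⟩ : ∃ t : V, (∀ x ∈ S, x ∉ C → T.Adj v x → r x = t) ∧
        ((∀ c ∈ C, T.Adj v c) → t = v) := by
      -- Either `v` opens a new component, or it inherits the label of any neighbour outside `C`;
      -- its neighbours form a clique, so they agree on the label.
      by_cases hKC : nbrIn T v S = C
      · refine ⟨v, fun x hx hxC hvx => absurd ?_ hxC, fun _ => rfl⟩
        rw [← hKC]; simp [hx, hvx]
      · obtain ⟨w, hw, hwC⟩ : ∃ w ∈ nbrIn T v S, w ∉ C := by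
          by_contra! hcon
          exact hKC (isNClique_eq_of_subset hK hC hcon)
        refine ⟨r w, fun x hx hxC hvx => ?_, fun hall => absurd ?_ hKC⟩
        · rcases eq_or_ne x w with rfl | hxw
          · rfl
          · exact hr x hx w (mem_nbrIn.1 hw).1 hxC hwC
              (hK.isClique (by simp [hx, hvx]) (by exact_mod_cast hw) hxw)
        · refine (isNClique_eq_of_subset hC hK fun c hc => ?_).symm
          simp [hS.subset hc, hall c hc]
    refine ⟨Function.update r v t, ?_, ?_⟩
    · intro x hx y hy hxC hyC hxy
      rcases Finset.mem_insert.1 hx with rfl | hxS <;> rcases Finset.mem_insert.1 hy with rfl | hyS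
      · rfl
      · rw [Function.update_self, Function.update_of_ne hxy.ne', ht y hyS hyC hxy]
      · rw [Function.update_self, Function.update_of_ne hxy.ne, ht x hxS hxC hxy.symm]
      · rw [Function.update_of_ne (by rintro rfl; exact hv hxS),
          Function.update_of_ne (by rintro rfl; exact hv hyS)]
        exact hr x hxS y hyS hxC hyC hxy
    · intro x hx hxC hall
      rcases Finset.mem_insert.1 hx with rfl | hxS
      · rw [Function.update_self, htC hall]
      · rw [Function.update_of_ne (by rintro rfl; exact hv hxS)]
        exact hroot x hxS hxC hall

/-- `U` is a set of vertices separated from the rest by `C`, in which `u` is the only vertex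
joined to all of `C`. -/
structure IsBranch (T : SimpleGraph V) (C : Finset V) (u : V) (U : Finset V) : Prop where
  mem : u ∈ U
  notMem : ∀ x ∈ U, x ∉ C
  not_adj : ∀ x ∈ U, ∀ y, y ∉ U → y ∉ C → ¬ T.Adj x y
  eq_of_adj : ∀ x ∈ U, (∀ c ∈ C, T.Adj x c) → x = u

lemma Grown.exists_isBranch [Fintype V] {C : Finset V} {u : V} (h : Grown k T C Finset.univ)
    (hC : T.IsNClique k C) (hu : u ∉ C) (hadj : ∀ c ∈ C, T.Adj u c) :
    ∃ U : Finset V, IsBranch T C u U := by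
  obtain ⟨r, hr, hroot⟩ := h.exists_root hC
  refine ⟨Finset.univ.filter fun x => x ∉ C ∧ r x = u, ?_, ?_, ?_, ?_⟩
  · simp [hu, hroot u (by simp) hu hadj]
  · intro x hx; simp at hx; exact hx.1
  · intro x hx y hy hyC hxy
    simp only [Finset.mem_filter, Finset.mem_univ, true_and] at hx hy
    exact hy ⟨hyC, (hr x (by simp) y (by simp) hx.1 hyC hxy) ▸ hx.2⟩
  · intro x hx hall
    simp only [Finset.mem_filter, Finset.mem_univ, true_and] at hx
    rw [← hx.2, hroot x (by simp) hx.1 hall]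

/-- The first vertex of `U` to be added has all its earlier neighbours in `C`, hence is joined to
all of `C`, hence is `u`. -/
lemma Grown.not_mem_branch {C S U : Finset V} {u : V} (h : Grown k T C S)
    (hC : T.IsNClique k C) (hU : IsBranch T C u U) (hu : u ∉ S) : ∀ x ∈ S, x ∉ U := by
  induction h with
  | refl => exact fun x hx hxU => hU.notMem x hxU hx
  | @step S v hS hv hK ih =>
    have ih := ih fun h => hu (Finset.mem_insert_of_mem h)
    intro x hx
    rcases Finset.mem_insert.1 hx with rfl | hx
    · intro hxU
      have hKC : nbrIn T x S ⊆ C := by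
        intro y hy
        rw [mem_nbrIn] at hy
        by_contra hyC
        exact hU.not_adj x hxU y (ih y hy.1) hyC hy.2
      have hEq := isNClique_eq_of_subset hK hC hKC
      have := hU.eq_of_adj x hxU fun c hc => by rw [← hEq] at hc; exact (mem_nbrIn.1 hc).2
      subst this
      simp at hu
    · exact ih x hx

/-- While `u` is absent its whole branch is absent, so `u` sees only `C`. Thus `u` can be added at
any moment; the same fact forces sub-`k`-trees to be induced. -/
lemma Grown.nbrIn_eq [Fintype V] {C S : Finset V} {u : V} (hT : Grown k T C Finset.univ)
    (h : Grown k T C S) (hC : T.IsNClique k C) (hu : u ∉ S) (hadj : ∀ c ∈ C, T.Adj u c) :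
    nbrIn T u S = C := by
  obtain ⟨U, hU⟩ := hT.exists_isBranch hC (fun h' => hu (h.subset h')) hadj
  ext y
  rw [mem_nbrIn]
  refine ⟨fun hy => ?_, fun hy => ⟨h.subset hy, hadj y hy⟩⟩
  by_contra hyC
  exact hU.not_adj u hU.mem y (h.not_mem_branch hC hU hu y hy.1) hyC hy.2

lemma Grown.restrict {C S : Finset V} (h : Grown k T C S) (W : V → Prop)
    [DecidablePred fun x => x ∈ C ∨ W x]
    (hW : ∀ x, W x → x ∉ C → ∀ y, ¬ W y → y ∉ C → ¬ T.Adj x y) :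
    Grown k T C (S.filter fun x => x ∈ C ∨ W x) := by
  induction h with
  | refl => rw [Finset.filter_true_of_mem fun x hx => Or.inl hx]; exact Grown.refl
  | @step S v hS hv hK ih =>
    have hvC : v ∉ C := fun h => hv (hS.subset h)
    rw [Finset.filter_insert]
    split_ifs with hvW
    · refine ih.step (by simp [hv]) ?_
      convert hK using 1
      ext y
      simp only [mem_nbrIn, Finset.mem_filter]
      refine ⟨fun hy => ⟨hy.1.1, hy.2⟩, fun hy => ⟨⟨hy.1, ?_⟩, hy.2⟩⟩
      by_contra! hcon
      exact hW v (hvW.resolve_left hvC) hvC y hcon.2 hcon.1 hy.2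
    · exact ih

lemma Grown.erase {C S : Finset V} {w : V} (h : Grown k T C S) (hw : w ∉ C)
    (hN : ∀ x ∈ S, T.Adj w x → x ∈ C) : Grown k T C (S.erase w) := by
  induction h with
  | refl => rw [Finset.erase_eq_of_notMem hw]; exact Grown.refl
  | @step S v hS hv hK ih =>
    have ih := ih fun x hx => hN x (Finset.mem_insert_of_mem hx)
    rcases eq_or_ne v w with rfl | hvw
    · rw [Finset.erase_eq_of_notMem hv] at ih
      rwa [Finset.erase_insert hv]
    · rw [Finset.erase_insert_of_ne hvw]
      refine ih.step (fun h => hv (Finset.mem_of_mem_erase h)) ?_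
      convert hK using 1
      ext y
      simp only [mem_nbrIn, Finset.mem_erase]
      refine ⟨fun hy => ⟨hy.1.2, hy.2⟩, fun hy => ⟨⟨?_, hy.1⟩, hy.2⟩⟩
      rintro rfl
      exact hv (hS.subset (hN v (Finset.mem_insert_self _ _) hy.2.symm))

lemma Grown.union {C S₁ S₂ : Finset V} (h₁ : Grown k T C S₁) (h₂ : Grown k T C S₂)
    (hS : ∀ x ∈ S₂, x ∉ C → x ∉ S₁ ∧ ∀ y ∈ S₁, y ∉ C → ¬ T.Adj x y) :
    Grown k T C (S₁ ∪ S₂) := by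
  induction h₂ with
  | refl => rwa [Finset.union_eq_left.2 h₁.subset]
  | @step S v hS₂ hv hK ih =>
    have hvC : v ∉ C := fun h => hv (hS₂.subset h)
    obtain ⟨hv1, hv2⟩ := hS v (by simp) hvC
    rw [Finset.union_insert]
    refine (ih fun x hx => hS x (Finset.mem_insert_of_mem hx)).step (by simp [hv, hv1]) ?_
    convert hK using 1
    ext y
    simp only [mem_nbrIn, Finset.mem_union]
    refine ⟨fun hy => ⟨?_, hy.2⟩, fun hy => ⟨Or.inr hy.1, hy.2⟩⟩
    rcases hy.1 with h | h
    · by_contra hyS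
      exact hv2 y h (fun hc => hyS (hS₂.subset hc)) hy.2
    · exact h

lemma Grown.card_nbrIn_ge {C S : Finset V} (h : Grown k T C S) (hC : T.IsNClique k C)
    (hS : k + 1 ≤ S.card) {x : V} (hx : x ∈ S) : k ≤ (nbrIn T x S).card := by
  induction h with
  | refl => rw [hC.card_eq] at hS; omega
  | @step S v hS' hv hK ih =>
    rcases Finset.mem_insert.1 hx with rfl | hx
    · rw [nbrIn_insert_of_not_adj (T.loopless.irrefl x), hK.card_eq]
    · rcases Nat.lt_or_ge k S.card with h | h
      · refine (ih h hx).trans (Finset.card_le_card fun y hy => ?_)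
        rw [mem_nbrIn] at hy ⊢
        exact ⟨Finset.mem_insert_of_mem hy.1, hy.2⟩
      · have hSC : nbrIn T v S = S :=
          Finset.eq_of_subset_of_card_le (nbrIn_subset _ _) (by rw [hK.card_eq]; exact h)
        have hQ := isNClique_insert_nbrIn hK
        rw [hSC] at hQ
        have : (insert v S).erase x ⊆ nbrIn T x (insert v S) := by
          intro y hy
          rw [Finset.mem_erase] at hy
          rw [mem_nbrIn]
          exact ⟨hy.2, hQ.isClique (by simp [hx]) (by exact_mod_cast hy.2) hy.1.symm⟩
        have h2 := Finset.card_le_card this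
        rw [Finset.card_erase_of_mem (by simp [hx]), hQ.card_eq] at h2
        omega

end Growth

/-! ### From recursive definitions on types to vertex sets of a fixed graph -/

section Transfer

open scoped Classical

variable {V W : Type u} {k : ℕ} {T : SimpleGraph V} {G : SimpleGraph W} {f : W → V}

/-- Path-type `k`-trees inside a fixed graph, as vertex sets. -/
inductive PathGrown (k : ℕ) (T : SimpleGraph V) : Finset V → Prop
  | clique {S : Finset V} (hS : T.IsNClique k S) : PathGrown k T S
  | clique_succ {S : Finset V} (hS : T.IsNClique (k + 1) S) : PathGrown k T S
  | step {S : Finset V} {w v : V} (h : PathGrown k T S) (hcard : k + 1 ≤ S.card) (hw : w ∉ S)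
      (hK : T.IsNClique k (nbrIn T w S)) (hv : v ∈ nbrIn T w S)
      (hleaf : (nbrIn T v S).card = k) : PathGrown k T (insert w S)

lemma isNClique_image {n : ℕ} (hf : f.Injective) (hom : ∀ x y, G.Adj x y → T.Adj (f x) (f y))
    {C : Finset W} (hC : G.IsNClique n C) : T.IsNClique n (C.image f) := by
  refine ⟨?_, by rw [Finset.card_image_of_injective _ hf, hC.card_eq]⟩
  rw [Finset.coe_image]
  rintro _ ⟨x, hx, rfl⟩ _ ⟨y, hy, rfl⟩ hxy
  exact hom _ _ (hC.isClique hx hy (by rintro rfl; exact hxy rfl))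

lemma exists_isNClique_image_eq {n : ℕ} (hf : f.Injective)
    (hom : ∀ x y, T.Adj (f x) (f y) → G.Adj x y) {S D : Finset V} (hS : (S : Set V) = Set.range f)
    (hDS : D ⊆ S) (hD : T.IsNClique n D) : ∃ C : Finset W, C.image f = D ∧ G.IsNClique n C := by
  have : (D : Set V) ⊆ f '' Set.univ := by rw [Set.image_univ, ← hS]; exact_mod_cast hDS
  obtain ⟨C, -, rfl⟩ := Finset.subset_set_image_iff.1 this
  refine ⟨C, rfl, fun x hx y hy hxy => hom _ _ (hD.isClique ?_ ?_ (hf.ne hxy)), ?_⟩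
  · exact_mod_cast Finset.mem_image_of_mem f hx
  · exact_mod_cast Finset.mem_image_of_mem f hy
  · rw [← hD.card_eq, Finset.card_image_of_injective _ hf]

lemma natCard_eq_card (hf : f.Injective) {S : Finset V} (hS : (S : Set V) = Set.range f) :
    Nat.card W = S.card := by
  rw [← Nat.card_range_of_injective hf, ← hS]
  simp

lemma ncard_neighborSet_eq (hf : f.Injective) (hadj : ∀ x y, T.Adj (f x) (f y) ↔ G.Adj x y)
    {S : Finset V} (hS : (S : Set V) = Set.range f) (w : W) :
    (G.neighborSet w).ncard = (nbrIn T (f w) S).card := by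
  rw [← Set.ncard_image_of_injective _ hf, ← Set.ncard_coe_finset]
  congr 1
  ext y
  have hy : y ∈ S ↔ y ∈ Set.range f := by rw [← hS]; simp
  simp only [Set.mem_image, SimpleGraph.mem_neighborSet, Finset.mem_coe, mem_nbrIn, hy]
  constructor
  · rintro ⟨x, hx, rfl⟩
    exact ⟨⟨x, rfl⟩, (hadj _ _).2 hx⟩
  · rintro ⟨⟨x, rfl⟩, hx⟩
    exact ⟨x, (hadj _ _).1 hx, rfl⟩

lemma isNClique_of_eq_top {n : ℕ} (hf : f.Injective)
    (hom : ∀ x y, G.Adj x y → T.Adj (f x) (f y)) {S : Finset V} (hS : (S : Set V) = Set.range f)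
    (hG : G = ⊤) (hcard : Nat.card W = n) : T.IsNClique n S := by
  refine ⟨?_, by rw [← natCard_eq_card hf hS, hcard]⟩
  rw [hS]
  rintro _ ⟨x, rfl⟩ _ ⟨y, rfl⟩ hxy
  refine hom _ _ ?_
  rw [hG]
  exact fun h => hxy (by rw [h])

lemma eq_top_of_isNClique {n : ℕ} (hf : f.Injective)
    (hom : ∀ x y, T.Adj (f x) (f y) → G.Adj x y) {S : Finset V} (hS : (S : Set V) = Set.range f)
    (h : T.IsNClique n S) : G = ⊤ := by
  ext x y
  refine ⟨fun h => h.ne, fun hxy => hom _ _ (h.isClique ?_ ?_ (hf.ne hxy))⟩ <;> rw [hS] <;> simp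

lemma coe_erase_eq_range (hf : f.Injective) {S : Finset V} (hS : (S : Set V) = Set.range f)
    (v : W) : ((S.erase (f v) : Finset V) : Set V) =
      Set.range (fun x : ({v}ᶜ : Set W) => f x) := by
  rw [Finset.coe_erase, hS]
  ext y
  constructor
  · rintro ⟨⟨x, rfl⟩, hx⟩
    exact ⟨⟨x, fun h => hx (by rw [Set.mem_singleton_iff.1 h]; rfl)⟩, rfl⟩
  · rintro ⟨⟨x, hx⟩, rfl⟩
    exact ⟨⟨x, rfl⟩, fun h => hx (hf h)⟩

lemma mem_of_coe_eq_range {S : Finset V} (hS : (S : Set V) = Set.range f) (v : W) : f v ∈ S := by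
  rw [← Finset.mem_coe, hS]; simp

lemma nbrIn_erase_eq_image (hf : f.Injective) (hadj : ∀ x y, T.Adj (f x) (f y) ↔ G.Adj x y)
    {S : Finset V} (hS : (S : Set V) = Set.range f) {v : W} {C : Finset ({v}ᶜ : Set W)}
    (hv : ∀ w : ({v}ᶜ : Set W), G.Adj v w ↔ w ∈ C) :
    nbrIn T (f v) (S.erase (f v)) = C.image (fun x : ({v}ᶜ : Set W) => f x) := by
  ext y
  rw [mem_nbrIn, ← Finset.mem_coe, coe_erase_eq_range hf hS, Finset.mem_image]
  constructor
  · rintro ⟨⟨x, rfl⟩, hx⟩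
    exact ⟨x, (hv x).1 ((hadj _ _).1 hx), rfl⟩
  · rintro ⟨x, hx, rfl⟩
    exact ⟨⟨x, rfl⟩, (hadj _ _).2 ((hv x).2 hx)⟩

/-- The disjunction serves two uses: an induced copy, or an arbitrary subgraph copy in a graph where
a vertex joined to `C` sees nothing else in a set grown from `C`. In the second case inducedness is
proved along the recursion, as each new vertex has no extra edges in `T`. -/
lemma IsKTree.grown_of_hom (h : IsKTree k G) : ∀ {f : W → V}, f.Injective →
    (∀ x y, G.Adj x y → T.Adj (f x) (f y)) → ∀ {S : Finset V}, (S : Set V) = Set.range f →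
    ((∀ x y, T.Adj (f x) (f y) → G.Adj x y) ∨ ∀ (S C : Finset V) (u : V), T.IsNClique k C →
      Grown k T C S → u ∉ S → (∀ c ∈ C, T.Adj u c) → nbrIn T u S = C) →
    (∃ C, T.IsNClique k C ∧ Grown k T C S) ∧ ∀ x y, T.Adj (f x) (f y) → G.Adj x y := by
  induction h with
  | complete G hcard hG =>
    intro f hf hom S hS _
    refine ⟨⟨S, isNClique_of_eq_top hf hom hS hG hcard, Grown.refl⟩, fun x y h => ?_⟩
    rw [hG]
    rintro rfl
    exact h.ne rfl
  | addVertex G v C hT hC hv ih =>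
    intro f hf hom S hS H
    have hf' : Function.Injective (fun x : ({v}ᶜ : Set _) => f x) :=
      hf.comp Subtype.val_injective
    obtain ⟨⟨C₀, hC₀, hG⟩, hrefl⟩ := ih (f := fun x => f x) hf' (fun x y h => hom _ _ h)
      (coe_erase_eq_range hf hS v) (H.imp_left fun h x y hxy => h _ _ hxy)
    have hD : T.IsNClique k (C.image fun x : ({v}ᶜ : Set _) => f x) :=
      isNClique_image hf' (fun x y h => hom _ _ h) hC
    have hDS : (C.image fun x : ({v}ᶜ : Set _) => f x) ⊆ S.erase (f v) := by
      intro y hy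
      obtain ⟨x, -, rfl⟩ := Finset.mem_image.1 hy
      exact mem_of_coe_eq_range (coe_erase_eq_range hf hS v) x
    have hN : nbrIn T (f v) (S.erase (f v)) = C.image fun x : ({v}ᶜ : Set _) => f x := by
      rcases H with H | H
      · exact nbrIn_erase_eq_image hf (fun x y => ⟨H x y, hom x y⟩) hS hv
      · refine H _ _ _ hD (hG.regrow hC₀ hD hDS) (by simp) ?_
        intro c hc
        obtain ⟨x, hx, rfl⟩ := Finset.mem_image.1 hc
        exact hom _ _ ((hv x).2 hx)
    have hvadj : ∀ y, T.Adj (f v) (f y) → G.Adj v y := by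
      intro y hy
      have hyv : y ≠ v := by rintro rfl; exact hy.ne rfl
      have : f y ∈ nbrIn T (f v) (S.erase (f v)) := by
        simp [hy, hf.ne hyv, mem_of_coe_eq_range hS]
      rw [hN] at this
      obtain ⟨x, hx, hxy⟩ := Finset.mem_image.1 this
      rw [← hf hxy]
      exact (hv x).2 hx
    refine ⟨⟨C₀, hC₀, ?_⟩, fun x y hxy => ?_⟩
    · have := hG.step (v := f v) (by simp) (hN ▸ hD)
      rwa [Finset.insert_erase (mem_of_coe_eq_range hS v)] at this
    · by_cases hx : x = v
      · subst hx; exact hvadj y hxy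
      · by_cases hy : y = v
        · subst hy; exact (hvadj x hxy.symm).symm
        · exact hrefl ⟨x, hx⟩ ⟨y, hy⟩ hxy

lemma coe_eq_range_of_insert {S : Finset V} (hf : f.Injective) {v : W} (hv : f v ∉ S)
    (hS : ((insert (f v) S : Finset V) : Set V) = Set.range f) :
    (S : Set V) = Set.range (fun x : ({v}ᶜ : Set W) => f x) := by
  rw [← coe_erase_eq_range hf hS, Finset.erase_insert hv]

lemma adj_iff_mem_of_image_eq {S : Finset V} (hf : f.Injective)
    (hadj : ∀ x y, T.Adj (f x) (f y) ↔ G.Adj x y) {v : W}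
    (hS : (S : Set V) = Set.range (fun x : ({v}ᶜ : Set W) => f x)) {C : Finset ({v}ᶜ : Set W)}
    (hC : (C.image fun x : ({v}ᶜ : Set W) => f x) = nbrIn T (f v) S) (w : ({v}ᶜ : Set W)) :
    G.Adj v w ↔ w ∈ C := by
  have hf' : Function.Injective (fun x : ({v}ᶜ : Set _) => f x) := hf.comp Subtype.val_injective
  rw [← hadj, ← hf'.mem_finset_image (s := C), hC, mem_nbrIn]
  exact ⟨fun h => ⟨mem_of_coe_eq_range hS w, h⟩, fun h => h.2⟩

lemma Grown.isKTree {C S : Finset V} (h : Grown k T C S) (hC : T.IsNClique k C) :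
    ∀ {W : Type u} {G : SimpleGraph W} {f : W → V}, f.Injective →
      (∀ x y, T.Adj (f x) (f y) ↔ G.Adj x y) → (S : Set V) = Set.range f → IsKTree k G := by
  induction h with
  | refl =>
    intro W G f hf hadj hS
    exact .complete G (by rw [natCard_eq_card hf hS, hC.card_eq])
      (eq_top_of_isNClique hf (fun x y => (hadj x y).1) hS hC)
  | @step S v hG hv hK ih =>
    intro W G f hf hadj hS
    obtain ⟨v, rfl⟩ : v ∈ Set.range f := by rw [← hS]; simp
    have hS' := coe_eq_range_of_insert hf hv hS
    have hf' : Function.Injective (fun x : ({v}ᶜ : Set _) => f x) :=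
      hf.comp Subtype.val_injective
    obtain ⟨D, hD, hDc⟩ := exists_isNClique_image_eq (G := G.induce ({v}ᶜ : Set W)) hf'
      (fun x y => (hadj x y).1) hS' (nbrIn_subset _ _) hK
    exact .addVertex G v D (ih hf' (fun x y => hadj x y) hS') hDc
      (adj_iff_mem_of_image_eq hf hadj hS' hD)

lemma IsPathTypeKTree.pathGrown (h : IsPathTypeKTree k G) : ∀ {f : W → V}, f.Injective →
    (∀ x y, T.Adj (f x) (f y) ↔ G.Adj x y) → ∀ {S : Finset V}, (S : Set V) = Set.range f →
    PathGrown k T S := by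
  induction h with
  | complete G hcard hG =>
    intro f hf hadj S hS
    exact .clique (isNClique_of_eq_top hf (fun x y => (hadj x y).2) hS hG hcard)
  | complete_succ G hcard hG =>
    intro f hf hadj S hS
    exact .clique_succ (isNClique_of_eq_top hf (fun x y => (hadj x y).2) hS hG hcard)
  | addVertex G v C hP horder hC hv ih =>
    intro f hf hadj S hS
    have hf' : Function.Injective (fun x : ({v}ᶜ : Set _) => f x) :=
      hf.comp Subtype.val_injective
    have hS' := coe_erase_eq_range hf hS v
    have hN := nbrIn_erase_eq_image hf hadj hS hv
    obtain ⟨hCl, z, hz, hleaf⟩ := hC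
    rw [← Finset.insert_erase (mem_of_coe_eq_range hS v)]
    refine .step (v := f z) (ih hf' (fun x y => hadj x y) hS') ?_ (by simp) ?_ ?_ ?_
    · rwa [← natCard_eq_card hf' hS']
    · rw [hN]
      exact isNClique_image hf' (fun x y => (hadj x y).2) hCl
    · rw [hN]
      exact Finset.mem_image_of_mem _ hz
    · rw [← hleaf]
      exact (ncard_neighborSet_eq (G := G.induce ({v}ᶜ : Set _)) hf'
        (fun x y => hadj x y) hS' z).symm

lemma PathGrown.isPathTypeKTree {S : Finset V} (h : PathGrown k T S) :
    ∀ {W : Type u} {G : SimpleGraph W} {f : W → V}, f.Injective →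
      (∀ x y, T.Adj (f x) (f y) ↔ G.Adj x y) → (S : Set V) = Set.range f →
      IsPathTypeKTree k G := by
  induction h with
  | clique hC =>
    intro W G f hf hadj hS
    exact .complete G (by rw [natCard_eq_card hf hS, hC.card_eq])
      (eq_top_of_isNClique hf (fun x y => (hadj x y).1) hS hC)
  | clique_succ hC =>
    intro W G f hf hadj hS
    exact .complete_succ G (by rw [natCard_eq_card hf hS, hC.card_eq])
      (eq_top_of_isNClique hf (fun x y => (hadj x y).1) hS hC)
  | @step S v z hG hcard hv hK hz hleaf ih =>
    intro W G f hf hadj hS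
    obtain ⟨v, rfl⟩ : v ∈ Set.range f := by rw [← hS]; simp
    have hS' := coe_eq_range_of_insert hf hv hS
    have hf' : Function.Injective (fun x : ({v}ᶜ : Set _) => f x) :=
      hf.comp Subtype.val_injective
    obtain ⟨D, hD, hDc⟩ := exists_isNClique_image_eq (G := G.induce ({v}ᶜ : Set W)) hf'
      (fun x y => (hadj x y).1) hS' (nbrIn_subset _ _) hK
    rw [← hD] at hz
    obtain ⟨z, hzD, rfl⟩ := Finset.mem_image.1 hz
    refine .addVertex G v D (ih hf' (fun x y => hadj x y) hS') ?_ ⟨hDc, z, hzD, ?_⟩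
      (adj_iff_mem_of_image_eq hf hadj hS' hD)
    · rwa [natCard_eq_card hf' hS']
    · rw [IsKLeaf, ← hleaf]
      exact ncard_neighborSet_eq (G := G.induce ({v}ᶜ : Set _)) hf'
        (fun x y => hadj x y) hS' z

end Transfer

/-! ### The mean order as an average over grown sets -/

section MeanOrder

open scoped Classical

variable {V : Type u} {k : ℕ} {T : SimpleGraph V}

lemma IsKTree.grown_univ [Fintype V] (h : IsKTree k T) {C : Finset V} (hC : T.IsNClique k C) :
    Grown k T C Finset.univ := by
  obtain ⟨⟨C₀, hC₀, hG⟩, -⟩ := h.grown_of_hom (T := T) (f := id) Function.injective_id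
    (fun _ _ h => h) (S := Finset.univ) (by simp) (Or.inl fun _ _ h => h)
  exact hG.regrow hC₀ hC (Finset.subset_univ _)

lemma isPathTypeKTree_iff_pathGrown [Fintype V] :
    IsPathTypeKTree k T ↔ PathGrown k T Finset.univ :=
  ⟨fun h => h.pathGrown (f := id) Function.injective_id (fun _ _ => Iff.rfl) (by simp),
    fun h => h.isPathTypeKTree (f := id) Function.injective_id (fun _ _ => Iff.rfl) (by simp)⟩

lemma isKLeaf_iff_card_nbrIn [Fintype V] {v : V} :
    IsKLeaf k T v ↔ (nbrIn T v Finset.univ).card = k := by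
  rw [IsKLeaf, ncard_neighborSet_eq (T := T) (f := id) Function.injective_id
    (fun _ _ => Iff.rfl) (S := Finset.univ) (by simp)]
  rfl

/-- The vertex sets of the sub-`k`-trees of `T` containing the `k`-clique `C`. -/
noncomputable def grownSets [Fintype V] (k : ℕ) (T : SimpleGraph V) (C : Finset V) :
    Finset (Finset V) :=
  Finset.univ.filter (Grown k T C)

@[simp] lemma mem_grownSets [Fintype V] {C S : Finset V} :
    S ∈ grownSets k T C ↔ Grown k T C S := by simp [grownSets]

/-- Subgraphs need not be induced, but `Grown.nbrIn_eq` makes those that are `k`-trees so; counting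
them is counting vertex sets. -/
lemma setOf_isSubKTree_eq [Fintype V] (hT : IsKTree k T) {C : Finset V} (hC : T.IsNClique k C)
    (i : ℕ) :
    {H : T.Subgraph | IsSubKTree k H ∧ (⊤ : T.Subgraph).induce (C : Set V) ≤ H ∧
      H.verts.ncard = i} = (fun S : Finset V => (⊤ : T.Subgraph).induce (S : Set V)) ''
        ((grownSets k T C).filter (fun S => S.card = i) : Finset (Finset V)) := by
  have hcl : ∀ (S C : Finset V) (u : V), T.IsNClique k C → Grown k T C S → u ∉ S →
      (∀ c ∈ C, T.Adj u c) → nbrIn T u S = C :=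
    fun S C u hC hS hu hadj => (hT.grown_univ hC).nbrIn_eq hS hC hu hadj
  ext H
  simp only [Set.mem_ofPred_eq, Set.mem_image, Finset.coe_filter, mem_grownSets]
  constructor
  · rintro ⟨h1, h2, h3⟩
    have hr : ((H.verts.toFinset : Finset V) : Set V) = Set.range (Subtype.val : H.verts → V) := by
      simp
    obtain ⟨⟨C₀, hC₀, hG⟩, hrefl⟩ := IsKTree.grown_of_hom (T := T) h1 (f := Subtype.val)
      Subtype.val_injective (fun x y h => h.adj_sub) hr (Or.inr hcl)
    refine ⟨H.verts.toFinset, ⟨hG.regrow hC₀ hC ?_, ?_⟩, ?_⟩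
    · intro x hx
      rw [Set.mem_toFinset]
      exact h2.1 (by simpa using hx)
    · rw [← h3, Set.ncard_eq_toFinset_card']
    · ext x y
      · simp
      · simp only [SimpleGraph.Subgraph.induce_adj, Set.coe_toFinset,
          SimpleGraph.Subgraph.top_adj]
        constructor
        · rintro ⟨hx, hy, hxy⟩
          exact hrefl ⟨x, hx⟩ ⟨y, hy⟩ hxy
        · intro h
          exact ⟨h.fst_mem, h.snd_mem, h.adj_sub⟩
  · rintro ⟨S, ⟨hS, rfl⟩, rfl⟩
    refine ⟨?_, ?_, ?_⟩
    · refine hS.isKTree hC (f := Subtype.val) Subtype.val_injective (fun x y => ?_) ?_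
      · have hx : x.1 ∈ S := by simpa using x.2
        have hy : y.1 ∈ S := by simpa using y.2
        simp [SimpleGraph.Subgraph.induce_adj, hx, hy]
      · simp
    · exact SimpleGraph.Subgraph.induce_mono_right (by exact_mod_cast hS.subset)
    · simp

lemma numSubKTrees_eq_card [Fintype V] (hT : IsKTree k T) {C : Finset V} (hC : T.IsNClique k C)
    (i : ℕ) : numSubKTrees k ((⊤ : T.Subgraph).induce (C : Set V)) i =
      ((grownSets k T C).filter (fun S => S.card = i)).card := by
  rw [numSubKTrees, setOf_isSubKTree_eq hT hC, Set.ncard_image_of_injective, Set.ncard_coe_finset]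
  intro S S' h
  have := congrArg SimpleGraph.Subgraph.verts h
  simpa using this

/-- The mean order at a `k`-clique as an average over vertex sets, with the offset `k` split off. -/
lemma cliqueMeanOrder_eq [Fintype V] (hT : IsKTree k T) {C : Finset V} (hC : T.IsNClique k C) :
    cliqueMeanOrder k T C = k + (∑ S ∈ grownSets k T C, (S.card - k : ℕ) : ℕ) /
      ((grownSets k T C).card : ℝ) := by
  have hmaps : ∀ S ∈ grownSets k T C, S.card ∈ Finset.Icc k (Nat.card V) := by
    intro S hS
    rw [Finset.mem_Icc, Nat.card_eq_fintype_card]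
    exact ⟨(mem_grownSets.1 hS).card_ge hC, Finset.card_le_univ S⟩
  have h1 : (localPolynomial k ((⊤ : T.Subgraph).induce (C : Set V))).eval 1 =
      ((grownSets k T C).card : ℝ) := by
    rw [localPolynomial, Finset.card_eq_sum_card_fiberwise hmaps]
    simp [Polynomial.eval_finsetSum, numSubKTrees_eq_card hT hC, hC.card_eq]
  have h2 : (localPolynomial k ((⊤ : T.Subgraph).induce (C : Set V))).derivative.eval 1 =
      ∑ S ∈ grownSets k T C, (S.card : ℝ) := by
    rw [localPolynomial, ← Finset.sum_fiberwise_of_maps_to hmaps]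
    simp only [SimpleGraph.Subgraph.induce_verts, Set.ncard_coe_finset, hC.card_eq,
      numSubKTrees_eq_card hT hC, Polynomial.derivative_sum, Polynomial.eval_finsetSum]
    refine Finset.sum_congr rfl fun i _ => ?_
    rw [Finset.sum_congr rfl fun S hS => by rw [(Finset.mem_filter.1 hS).2]]
    simp [Polynomial.derivative_X_pow, mul_comm]
  have h3 : ∑ S ∈ grownSets k T C, (S.card : ℝ) =
      (grownSets k T C).card * k + (∑ S ∈ grownSets k T C, (S.card - k : ℕ) : ℕ) := by
    push_cast
    rw [← nsmul_eq_mul, ← Finset.sum_const, ← Finset.sum_add_distrib]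
    refine Finset.sum_congr rfl fun S hS => ?_
    rw [Nat.cast_sub (Finset.mem_Icc.1 (hmaps S hS)).1]
    ring
  have h0 : ((grownSets k T C).card : ℝ) ≠ 0 :=
    Nat.cast_ne_zero.2 (Finset.card_ne_zero_of_mem (mem_grownSets.2 Grown.refl))
  rw [cliqueMeanOrder, localMeanOrder, h1, h2, h3]
  field_simp

end MeanOrder

/-! ### Numerical inequalities -/

section Counting

/-- Gap-free values, in increasing order, are at most `0, 1, 2, …`, with equality exactly when none
repeats. The induction removes an element of maximal value. -/
lemma two_mul_sum_le {α : Type*} (s : Finset α) (f : α → ℕ)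
    (h : ∀ a ∈ s, ∀ i < f a, ∃ b ∈ s, f b = i) :
    2 * ∑ a ∈ s, f a ≤ s.card * (s.card - 1) ∧
      (2 * ∑ a ∈ s, f a = s.card * (s.card - 1) ↔ Set.InjOn f s) := by
  classical
  induction s using Finset.induction_on_max_value f with
  | empty => simp
  | @insert a s ha hmax ih =>
    have hdown : ∀ b ∈ s, ∀ i < f b, ∃ c ∈ s, f c = i := by
      intro b hb i hi
      obtain ⟨c, hc, hci⟩ := h b (by simp [hb]) i hi
      rcases Finset.mem_insert.1 hc with rfl | hc
      · have := hmax b hb; omega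
      · exact ⟨c, hc, hci⟩
    obtain ⟨ih1, ih2⟩ := ih hdown
    have hsub : Finset.range (f a) ⊆ s.image f := by
      intro i hi
      obtain ⟨c, hc, hci⟩ := h a (by simp) i (Finset.mem_range.1 hi)
      rcases Finset.mem_insert.1 hc with rfl | hc
      · rw [Finset.mem_range] at hi; omega
      · exact Finset.mem_image.2 ⟨c, hc, hci⟩
    have hfa : f a ≤ s.card := by
      simpa using (Finset.card_le_card hsub).trans Finset.card_image_le
    have hsum : 2 * ∑ b ∈ insert a s, f b = 2 * f a + 2 * ∑ b ∈ s, f b := by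
      rw [Finset.sum_insert ha]; ring
    have hcard : (insert a s).card * ((insert a s).card - 1) =
        2 * s.card + s.card * (s.card - 1) := by
      rw [Finset.card_insert_of_notMem ha, Nat.add_sub_cancel]
      rcases s.card with _ | n
      · rfl
      · simp only [Nat.add_sub_cancel]; ring
    rw [hsum, hcard, Finset.coe_insert, Set.injOn_insert (by simpa using ha), ← ih2]
    refine ⟨by omega, fun heq => ⟨by omega, ?_⟩, fun ⟨heq, hnot⟩ => ?_⟩
    · rintro ⟨b, hb, hba⟩
      have himg : s.image f = Finset.range (f a) := by
        refine (Finset.eq_of_subset_of_card_le hsub ?_).symm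
        rw [Finset.card_range]
        exact Finset.card_image_le.trans (by omega)
      have : f b ∈ Finset.range (f a) := himg ▸ Finset.mem_image_of_mem f hb
      rw [Finset.mem_range] at this
      omega
    · have hinj := ih2.1 heq
      have himg : s.image f ⊆ Finset.range (f a) := by
        intro i hi
        obtain ⟨b, hb, rfl⟩ := Finset.mem_image.1 hi
        exact Finset.mem_range.2 (lt_of_le_of_ne (hmax b hb) fun hba => hnot ⟨b, hb, hba⟩)
      have := Finset.card_le_card himg
      rw [Finset.card_image_of_injOn hinj, Finset.card_range] at this
      omega

lemma div_comparison {a c s t : ℕ} (ha : 1 ≤ a) (hc : 1 ≤ c) (hct : c ≤ t)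
    (hs : 2 * s ≤ a * (a - 1)) :
    ((s + (c * s + a * t) : ℕ) : ℝ) / (a + a * c : ℕ) ≤
        ((c * s + a * t : ℕ) : ℝ) / (1 + a * c : ℕ) ∧
      (((c * s + a * t : ℕ) : ℝ) / (1 + a * c : ℕ) =
          ((s + (c * s + a * t) : ℕ) : ℝ) / (a + a * c : ℕ) ↔
        a = 1 ∨ c = 1 ∧ t = 1 ∧ 2 * s = a * (a - 1)) := by
  obtain ⟨a, rfl⟩ := Nat.exists_eq_add_of_le' ha
  obtain ⟨c, rfl⟩ := Nat.exists_eq_add_of_le' hc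
  obtain ⟨d, rfl⟩ := Nat.exists_eq_add_of_le hct
  rw [Nat.add_sub_cancel] at hs ⊢
  obtain ⟨e, he⟩ := Nat.exists_eq_add_of_le hs
  have h1 : (0 : ℝ) < ((a + 1) + (a + 1) * (c + 1) : ℕ) := by positivity
  have h2 : (0 : ℝ) < (1 + (a + 1) * (c + 1) : ℕ) := by positivity
  -- Here `a` and `c` are shifted down by one, `d` is the slack in `c ≤ t` and `e` the slack in
  -- `hs`. The difference of cross products is a sum of nonnegative terms, whose vanishing decides
  -- equality.
  have key : ((c + 1) * s + (a + 1) * (c + 1 + d)) * ((a + 1) + (a + 1) * (c + 1)) =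
      (s + ((c + 1) * s + (a + 1) * (c + 1 + d))) * (1 + (a + 1) * (c + 1)) +
        (d * ((a + 1) * a) + (c + 1) * e + c * s) := by
    have : (c + 1) * ((a + 1) * a) = (c + 1) * (2 * s + e) := by rw [he]
    zify at this ⊢
    linear_combination this
  rw [div_le_div_iff₀ h1 h2, div_eq_div_iff h2.ne' h1.ne']
  norm_cast
  rw [key]
  refine ⟨by omega, ?_⟩
  rw [Nat.add_eq_left]
  constructor
  · intro h
    simp only [Nat.add_eq_zero_iff, mul_eq_zero] at h
    rcases Nat.eq_zero_or_pos a with rfl | hpos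
    · left; rfl
    · right
      have he0 : e = 0 := by omega
      subst he0
      have : 0 < (a + 1) * a := by positivity
      omega
  · rintro (h | ⟨h1, h2, h3⟩)
    · obtain rfl : a = 0 := by omega
      simp only [mul_zero] at he
      obtain rfl : s = 0 := by omega
      obtain rfl : e = 0 := by omega
      simp
    · obtain rfl : c = 0 := by omega
      obtain rfl : d = 0 := by omega
      obtain rfl : e = 0 := by omega
      simp

end Counting

/-! ### Path-type trees and uniqueness of orders -/

section Path

open scoped Classical

variable {V : Type u} {k : ℕ} {T : SimpleGraph V}

lemma Grown.isNClique_nbrIn {C S : Finset V} (h : Grown k T C S) (hC : T.IsNClique k C)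
    (hne : S ≠ C) {z : V} (hz : z ∈ C) (hleaf : (nbrIn T z S).card = k) :
    T.IsNClique k (nbrIn T z S) := by
  obtain ⟨y, hyS, hyC, hy⟩ := h.exists_first hC hne
  have hQ := hC.insert hy
  have hsub : (insert y C).erase z ⊆ nbrIn T z S := by
    intro x hx
    rw [Finset.mem_erase] at hx
    rw [mem_nbrIn]
    refine ⟨?_, hQ.isClique (by simp [hz]) (by exact_mod_cast hx.2) hx.1.symm⟩
    rcases Finset.mem_insert.1 hx.2 with rfl | hx
    · exact hyS
    · exact h.subset hx
  have hcard : ((insert y C).erase z).card = k := by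
    rw [Finset.card_erase_of_mem (by simp [hz]), hQ.card_eq]; rfl
  rw [← Finset.eq_of_subset_of_card_le hsub (by rw [hcard, hleaf])]
  exact ⟨hQ.isClique.subset (by exact_mod_cast Finset.erase_subset _ _), hcard⟩

lemma PathGrown.exists_grown {S : Finset V} (h : PathGrown k T S) :
    ∃ C, T.IsNClique k C ∧ Grown k T C S := by
  induction h with
  | @clique S hS => exact ⟨S, hS, .refl⟩
  | @clique_succ S hS =>
    obtain ⟨x, hx⟩ : S.Nonempty := Finset.card_pos.1 (by rw [hS.card_eq]; omega)
    have hc : T.IsNClique k (S.erase x) :=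
      ⟨hS.isClique.subset (by simp), by rw [Finset.card_erase_of_mem hx, hS.card_eq]; rfl⟩
    refine ⟨S.erase x, hc, ?_⟩
    have := (Grown.refl (k := k) (T := T) (C := S.erase x)).step (v := x) (by simp)
      (by rwa [nbrIn_eq_self fun c hc => hS.isClique (by simpa using hx)
        (by exact_mod_cast Finset.mem_of_mem_erase hc) (Finset.ne_of_mem_erase hc).symm])
    rwa [Finset.insert_erase hx] at this
  | step _ _ hw hK _ _ ih =>
    obtain ⟨C, hC, hG⟩ := ih
    exact ⟨C, hC, hG.step hw hK⟩

/-- Two consecutive additions must be adjacent, since otherwise either could come first, giving two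
sets of one order. So each new vertex is attached to the previous one, which is then a leaf. -/
lemma Grown.pathGrown {C S : Finset V} (h : Grown k T C S) (hC : T.IsNClique k C)
    (hinj : Set.InjOn Finset.card {X | Grown k T C X}) : PathGrown k T S := by
  induction h with
  | refl => exact .clique hC
  | @step S v hS hv hK ih =>
    cases hS with
    | refl =>
      have := isNClique_insert_nbrIn hK
      rw [isNClique_eq_of_subset hK hC (nbrIn_subset _ _)] at this
      exact .clique_succ this
    | @step S' w hS' hw hKw =>
      refine .step (v := w) ih ?_ hv hK ?_ ?_
      · rw [Finset.card_insert_of_notMem hw]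
        have := hS'.card_ge hC
        omega
      · by_contra hcon
        have hvw : ¬ T.Adj v w := fun h => hcon (by simp [h])
        rw [nbrIn_insert_of_not_adj hvw] at hK
        have hvS' : v ∉ S' := fun h => hv (Finset.mem_insert_of_mem h)
        have heq := hinj (hS'.step hvS' hK) (hS'.step hw hKw)
          (by rw [Finset.card_insert_of_notMem hvS', Finset.card_insert_of_notMem hw])
        exact hv (heq ▸ Finset.mem_insert_self v S')
      · rw [nbrIn_insert_of_not_adj (T.loopless.irrefl w), hKw.card_eq]

/-- Induction along the path, with `C` and its leaf `z` arbitrary: the hypothesis is needed both for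
`C` and for the attaching clique of the last vertex `w`, which contains the leaf `v`. -/
lemma PathGrown.injOn_card {S : Finset V} (h : PathGrown k T S) :
    ∀ {C : Finset V} {z : V}, T.IsNClique k C → C ⊆ S → z ∈ C → (nbrIn T z S).card = k →
      Set.InjOn Finset.card {X | Grown k T C X ∧ X ⊆ S} := by
  induction h with
  | @clique S hS =>
    intro C z hC hCS hz hleaf
    exfalso
    have hlt : (nbrIn T z S).card < S.card :=
      Finset.card_lt_card ⟨nbrIn_subset _ _, fun h => by simpa using h (hCS hz)⟩
    rw [hS.card_eq] at hlt
    omega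
  | @clique_succ S hS =>
    intro C z hC hCS hz hleaf X hX X' hX' hcard
    have h1 := Finset.card_le_card hX.2
    rw [hS.card_eq] at h1
    have h2 := hX.1.card_ge hC
    rcases Nat.lt_or_ge k X.card with h | h
    · rw [Finset.eq_of_subset_of_card_le hX.2 (by rw [hS.card_eq]; exact h),
        Finset.eq_of_subset_of_card_le hX'.2 (by rw [hS.card_eq, ← hcard]; exact h)]
    · rw [← Finset.eq_of_subset_of_card_le hX.1.subset (by rw [hC.card_eq]; exact h),
        ← Finset.eq_of_subset_of_card_le hX'.1.subset (by rw [hC.card_eq, ← hcard]; exact h)]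
  | @step S w v hP hS hw hK hv hvleaf ih =>
    intro C z hC hCS hz hleaf
    have ihD := ih hK (nbrIn_subset _ _) hv hvleaf
    obtain ⟨C₀, hC₀, hG₀⟩ := hP.exists_grown
    have hNw : ∀ X ⊆ insert w S, ∀ x ∈ X, T.Adj w x → x ∈ nbrIn T w S := by
      intro X hX x hx hwx
      rw [mem_nbrIn]
      exact ⟨(Finset.mem_insert.1 (hX hx)).resolve_left hwx.ne', hwx⟩
    have herase : ∀ X, Grown k T C X → X ⊆ insert w S → nbrIn T w S ⊆ X →
        Grown k T (nbrIn T w S) (X.erase w) ∧ X.erase w ⊆ S := by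
      intro X hX hXS hD
      exact ⟨(hX.regrow hC hK hD).erase (by simp) (hNw X hXS),
        Finset.subset_insert_iff.1 hXS⟩
    rcases eq_or_ne z w with rfl | hzw
    -- Here `z` is the last vertex. Any larger `X` contains the only `(k+1)`-clique through `z`, so
    -- erasing `z` leaves a set grown from the attaching clique.
    · have hbig : ∀ X, Grown k T C X → X ⊆ insert z S → X ≠ C → nbrIn T z S ⊆ X := by
        intro X hX hXS hne
        obtain ⟨y, hyX, hyC, hy⟩ := hX.exists_first hC hne
        have hQX : insert y C ⊆ X := Finset.insert_subset hyX hX.subset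
        have hQ := hC.insert hy
        have hsub : insert y C ⊆ insert z (nbrIn T z S) := by
          intro x hx
          rcases eq_or_ne x z with rfl | hxz
          · simp
          · refine Finset.mem_insert_of_mem (hNw X hXS x (hQX hx) ?_)
            exact hQ.isClique (by simp [hz]) (by exact_mod_cast hx) hxz.symm
        rw [isNClique_eq_of_subset hQ (isNClique_insert_nbrIn hK) hsub] at hQX
        exact (Finset.subset_insert _ _).trans hQX
      have hEq : ∀ X X', Grown k T C X → X.card = X'.card → Grown k T C X' → X = C → X = X' := by
        rintro X X' hX hcard hX' rfl
        exact Finset.eq_of_subset_of_card_le hX'.subset hcard.ge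
      intro X hX X' hX' hcard
      by_cases h1 : X = C
      · exact hEq X X' hX.1 hcard hX'.1 h1
      by_cases h2 : X' = C
      · exact (hEq X' X hX'.1 hcard.symm hX.1 h2).symm
      have hzX := hX.1.subset hz
      have hzX' := hX'.1.subset hz
      have := ihD (herase X hX.1 hX.2 (hbig X hX.1 hX.2 h1))
        (herase X' hX'.1 hX'.2 (hbig X' hX'.1 hX'.2 h2))
        (by rw [Finset.card_erase_of_mem hzX, Finset.card_erase_of_mem hzX', hcard])
      rw [← Finset.insert_erase hzX, this, Finset.insert_erase hzX']
    · have hzS : z ∈ S := (Finset.mem_insert.1 (hCS hz)).resolve_left hzw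
      -- Already in `S` the vertex `z` has at least `k` neighbours, so `w` cannot be one of them and
      -- `z` is a leaf of `S` too.
      have hNz : nbrIn T z S = nbrIn T z (insert w S) := by
        refine Finset.eq_of_subset_of_card_le (fun x hx => ?_) ?_
        · rw [mem_nbrIn] at hx ⊢
          exact ⟨Finset.mem_insert_of_mem hx.1, hx.2⟩
        · rw [hleaf]
          exact hG₀.card_nbrIn_ge hC₀ hS hzS
      have hzw' : ¬ T.Adj z w := by
        intro h
        have : w ∈ nbrIn T z (insert w S) := by simp [h]
        rw [← hNz, mem_nbrIn] at this
        exact hw this.1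
      rw [← hNz] at hleaf
      have hwC : w ∉ C := fun h => hzw' (hC.isClique hz h hzw)
      have hCS : C ⊆ S := by rwa [Finset.subset_insert_iff_of_notMem hwC] at hCS
      have hzD : z ∉ nbrIn T w S := fun h => hzw' (mem_nbrIn.1 h).2.symm
      have ihC := ih hC hCS hz hleaf
      have hGC := hG₀.regrow hC₀ hC hCS
      have hSC : S ≠ C := by
        rintro rfl
        rw [hC.card_eq] at hS
        omega
      have hNc := hGC.isNClique_nbrIn hC hSC hz hleaf
      have hSz : Grown k T (nbrIn T w S) (S.erase z) := by
        refine Grown.regrow ((hGC.regrow hC hNc (nbrIn_subset _ _)).erase (w := z) (by simp)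
          (by simp +contextual)) hNc hK ?_
        exact Finset.subset_erase.2 ⟨nbrIn_subset _ _, hzD⟩
      have htop : ∀ X, Grown k T C X → X ⊆ insert w S → w ∈ X → X = insert w S := by
        intro X hX hXS hwX
        have hcard : k + 1 ≤ X.card := by
          rw [← hC.card_eq, ← Finset.card_insert_of_notMem hwC]
          exact Finset.card_le_card (Finset.insert_subset hwX hX.subset)
        have hD : nbrIn T w X = nbrIn T w S := by
          refine Finset.eq_of_subset_of_card_le (fun x hx => ?_) ?_
          · rw [mem_nbrIn] at hx
            exact hNw X hXS x hx.1 hx.2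
          · rw [hK.card_eq]
            exact hX.card_nbrIn_ge hC hcard hwX
        obtain ⟨hE, hES⟩ := herase X hX hXS (hD ▸ nbrIn_subset _ _)
        suffices X.erase w = S by rw [← this, Finset.insert_erase hwX]
        -- A proper `X.erase w` contains `z`, but `S.erase z` is also grown from the attaching
        -- clique and yields a set `Y` of the same order without `z`, against uniqueness there.
        by_contra hne
        have hlt := Finset.card_lt_card (Finset.ssubset_iff_subset_ne.2 ⟨hES, hne⟩)
        obtain ⟨Y, hYS, hY, hYc⟩ := hSz.exists_card_eq hK (hE.card_ge hK)
          (by rw [Finset.card_erase_of_mem hzS]; omega)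
        have hYX := ihD ⟨hY, hYS.trans (Finset.erase_subset _ _)⟩ ⟨hE, hES⟩ hYc
        have hzY : z ∈ Y := hYX ▸ Finset.mem_erase.2 ⟨hzw, hX.subset hz⟩
        simpa using hYS hzY
      have hmixed : ∀ X X', X.card = X'.card → w ∈ X → w ∉ X' → Grown k T C X →
          X ⊆ insert w S → X' ⊆ insert w S → False := by
        intro X X' hcard h1 h2 hX hXS hX'S
        rw [htop X hX hXS h1, Finset.card_insert_of_notMem hw] at hcard
        rw [Finset.subset_insert_iff_of_notMem h2] at hX'S
        have := Finset.card_le_card hX'S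
        omega
      intro X hX X' hX' hcard
      by_cases h1 : w ∈ X <;> by_cases h2 : w ∈ X'
      · rw [htop X hX.1 hX.2 h1, htop X' hX'.1 hX'.2 h2]
      · exact (hmixed X X' hcard h1 h2 hX.1 hX.2 hX'.2).elim
      · exact (hmixed X' X hcard.symm h2 h1 hX'.1 hX'.2 hX.2).elim
      · exact ihC ⟨hX.1, by rw [← Finset.subset_insert_iff_of_notMem h1]; exact hX.2⟩
          ⟨hX'.1, by rw [← Finset.subset_insert_iff_of_notMem h2]; exact hX'.2⟩ hcard

end Path

/-! ### Splitting the two families at `u`, and the equality case -/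

section Comparison

open scoped Classical

variable {V : Type u} [Fintype V] {k : ℕ} {T : SimpleGraph V} {C : Finset V} {u : V}

/-- The members of `grownSets k T C` avoiding `u`. -/
noncomputable def avoidSets (k : ℕ) (T : SimpleGraph V) (C : Finset V) (u : V) :
    Finset (Finset V) :=
  (grownSets k T C).filter (u ∉ ·)

/-- The members of `grownSets k T C` containing `u`. -/
noncomputable def throughSets (k : ℕ) (T : SimpleGraph V) (C : Finset V) (u : V) :
    Finset (Finset V) :=
  (grownSets k T C).filter (u ∈ ·)

/-- The members of `grownSets k T C` containing `u` and contained in `C ∪ U`. -/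
noncomputable def branchSets (k : ℕ) (T : SimpleGraph V) (C : Finset V) (u : V) (U : Finset V) :
    Finset (Finset V) :=
  (throughSets k T C u).filter fun S => ∀ x ∈ S, x ∈ C ∨ x ∈ U

@[simp] lemma mem_avoidSets {S : Finset V} :
    S ∈ avoidSets k T C u ↔ Grown k T C S ∧ u ∉ S := by simp [avoidSets]

@[simp] lemma mem_throughSets {S : Finset V} :
    S ∈ throughSets k T C u ↔ Grown k T C S ∧ u ∈ S := by simp [throughSets]

@[simp] lemma mem_branchSets {S U : Finset V} :
    S ∈ branchSets k T C u U ↔ (Grown k T C S ∧ u ∈ S) ∧ ∀ x ∈ S, x ∈ C ∨ x ∈ U := by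
  simp [branchSets]

lemma IsBranch.inter_eq {U S₁ S₂ : Finset V} (hC : T.IsNClique k C) (hU : IsBranch T C u U)
    (h₁ : S₁ ∈ avoidSets k T C u) (h₂ : S₂ ∈ branchSets k T C u U) : S₁ ∩ S₂ = C := by
  rw [mem_avoidSets] at h₁
  rw [mem_branchSets] at h₂
  refine Finset.Subset.antisymm (fun x hx => ?_)
    (Finset.subset_inter h₁.1.subset h₂.1.1.subset)
  rw [Finset.mem_inter] at hx
  exact (h₂.2 x hx.2).resolve_right (h₁.1.not_mem_branch hC hU h₁.2 x hx.1)

/-- No edge joins `U` to the outside of `C ∪ U`, so cutting along `C` is a bijection. A general `F`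
yields both the count and the total offset. -/
lemma IsBranch.sum_throughSets {U : Finset V} (hC : T.IsNClique k C) (hu : u ∉ C)
    (hU : IsBranch T C u U) (F : Finset V → ℕ) :
    ∑ S ∈ throughSets k T C u, F S =
      ∑ p ∈ avoidSets k T C u ×ˢ branchSets k T C u U, F (p.1 ∪ p.2) := by
  have hsplit : ∀ S : Finset V, (S.filter fun x => x ∈ C ∨ x ∉ U) ∪
      (S.filter fun x => x ∈ C ∨ x ∈ U) = S := by
    intro S
    ext x
    simp only [Finset.mem_union, Finset.mem_filter]
    tauto
  refine Finset.sum_nbij'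
    (fun S => (S.filter fun x => x ∈ C ∨ x ∉ U, S.filter fun x => x ∈ C ∨ x ∈ U))
    (fun p => p.1 ∪ p.2) ?_ ?_ ?_ ?_ ?_
  · intro S hS
    rw [mem_throughSets] at hS
    simp only [Finset.mem_product, mem_avoidSets, mem_branchSets]
    refine ⟨⟨hS.1.restrict (fun x => x ∉ U) fun x hx hxC y hy _ hxy => ?_, ?_⟩,
      ⟨hS.1.restrict (fun x => x ∈ U) fun x hx _ y hy hyC => hU.not_adj x hx y hy hyC, ?_⟩, ?_⟩
    · exact hU.not_adj y (not_not.1 hy) x hx hxC hxy.symm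
    · simp [hu, hU.mem]
    · simp [hS.2, hU.mem]
    · simp
  · rintro ⟨S₁, S₂⟩ h
    simp only [Finset.mem_product, mem_avoidSets, mem_branchSets] at h
    obtain ⟨⟨h1, h1u⟩, ⟨h2, h2u⟩, h2U⟩ := h
    rw [mem_throughSets]
    have hav := h1.not_mem_branch hC hU h1u
    refine ⟨h1.union h2 fun x hx hxC => ?_, by simp [h2u]⟩
    have hxU := (h2U x hx).resolve_left hxC
    exact ⟨fun hx1 => hav x hx1 hxU, fun y hy hyC => hU.not_adj x hxU y (hav y hy) hyC⟩
  · intro S _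
    exact hsplit S
  · rintro ⟨S₁, S₂⟩ h
    simp only [Finset.mem_product, mem_avoidSets, mem_branchSets] at h
    obtain ⟨⟨h1, h1u⟩, ⟨h2, h2u⟩, h2U⟩ := h
    have hav := h1.not_mem_branch hC hU h1u
    have hs1 := h1.subset
    have hs2 := h2.subset
    simp only [Prod.mk.injEq]
    constructor
    · ext x
      simp only [Finset.mem_union, Finset.mem_filter]
      refine ⟨fun ⟨h, h'⟩ => ?_, fun h => ⟨Or.inl h, Or.inr (hav x h)⟩⟩
      rcases h with h | h
      · exact h
      · rcases h' with h' | h'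
        · exact hs1 h'
        · exact hs1 ((h2U x h).resolve_right h')
    · ext x
      simp only [Finset.mem_union, Finset.mem_filter]
      refine ⟨fun ⟨h, h'⟩ => ?_, fun h => ⟨Or.inr h, h2U x h⟩⟩
      rcases h with h | h
      · rcases h' with h' | h'
        · exact hs2 h'
        · exact absurd h' (hav x h)
      · exact h
  · intro S _
    rw [hsplit S]

lemma IsBranch.card_throughSets {U : Finset V} (hC : T.IsNClique k C) (hu : u ∉ C)
    (hU : IsBranch T C u U) : (throughSets k T C u).card =
      (avoidSets k T C u).card * (branchSets k T C u U).card := by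
  have := hU.sum_throughSets hC hu fun _ => 1
  simpa [Finset.card_product] using this

lemma IsBranch.sum_card_throughSets {U : Finset V} (hC : T.IsNClique k C) (hu : u ∉ C)
    (hU : IsBranch T C u U) : ∑ S ∈ throughSets k T C u, (S.card - k) =
      (branchSets k T C u U).card * ∑ S ∈ avoidSets k T C u, (S.card - k) +
        (avoidSets k T C u).card * ∑ S ∈ branchSets k T C u U, (S.card - k) := by
  have hadd : ∀ p ∈ avoidSets k T C u ×ˢ branchSets k T C u U,
      (p.1 ∪ p.2).card - k = (p.1.card - k) + (p.2.card - k) := by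
    rintro ⟨S₁, S₂⟩ h
    rw [Finset.mem_product] at h
    have h1 := Finset.card_union_add_card_inter S₁ S₂
    rw [hU.inter_eq hC h.1 h.2, hC.card_eq] at h1
    have h2 := (mem_avoidSets.1 h.1).1.card_ge hC
    have h3 := (mem_branchSets.1 h.2).1.1.card_ge hC
    simp only at *
    omega
  rw [hU.sum_throughSets hC hu, Finset.sum_congr rfl hadd, Finset.sum_add_distrib,
    Finset.sum_product, Finset.sum_product]
  simp [Finset.mul_sum]

lemma card_add_one_le_of_mem_branchSets {U S : Finset V} (hC : T.IsNClique k C) (hu : u ∉ C)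
    (hS : S ∈ branchSets k T C u U) : k + 1 ≤ S.card := by
  rw [mem_branchSets] at hS
  rw [← hC.card_eq, ← Finset.card_insert_of_notMem hu]
  exact Finset.card_le_card (Finset.insert_subset hS.1.2 hS.1.1.subset)

lemma card_branchSets_le_sum {U : Finset V} (hC : T.IsNClique k C) (hu : u ∉ C) :
    (branchSets k T C u U).card ≤ ∑ S ∈ branchSets k T C u U, (S.card - k) := by
  rw [Finset.card_eq_sum_ones]
  refine Finset.sum_le_sum fun S hS => ?_
  have := card_add_one_le_of_mem_branchSets hC hu hS
  omega

lemma Grown.insert_of_adj {S : Finset V} (hT : Grown k T C Finset.univ) (h : Grown k T C S)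
    (hC : T.IsNClique k C) (hu : u ∉ S) (hadj : ∀ c ∈ C, T.Adj u c) :
    Grown k T C (insert u S) :=
  h.step hu (by rwa [hT.nbrIn_eq h hC hu hadj])

lemma insert_mem_branchSets {U : Finset V} (hT : Grown k T C Finset.univ) (hC : T.IsNClique k C)
    (hu : u ∉ C) (hadj : ∀ c ∈ C, T.Adj u c) (hU : IsBranch T C u U) :
    insert u C ∈ branchSets k T C u U := by
  rw [mem_branchSets]
  refine ⟨⟨hT.insert_of_adj .refl hC hu hadj, by simp⟩, fun x hx => ?_⟩
  rcases Finset.mem_insert.1 hx with rfl | hx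
  · exact Or.inr hU.mem
  · exact Or.inl hx

lemma self_mem_avoidSets (hu : u ∉ C) : C ∈ avoidSets k T C u :=
  mem_avoidSets.2 ⟨.refl, hu⟩

/-- Stopping at an intermediate order inside an avoiding set still avoids `u`, so the offsets have
no gaps. -/
lemma two_mul_sum_avoidSets_le (hC : T.IsNClique k C) :
    2 * ∑ S ∈ avoidSets k T C u, (S.card - k) ≤
        (avoidSets k T C u).card * ((avoidSets k T C u).card - 1) ∧
      (2 * ∑ S ∈ avoidSets k T C u, (S.card - k) =
        (avoidSets k T C u).card * ((avoidSets k T C u).card - 1) ↔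
          Set.InjOn Finset.card (avoidSets k T C u : Set (Finset V))) := by
  have h := two_mul_sum_le (avoidSets k T C u) (fun S => S.card - k) (by
    intro S hS i hi
    rw [mem_avoidSets] at hS
    obtain ⟨S', h1, h2, h3⟩ := hS.1.exists_card_eq hC (i := i + k) (by omega) (by omega)
    exact ⟨S', mem_avoidSets.2 ⟨h2, fun h => hS.2 (h1 h)⟩, by simp [h3]⟩)
  refine ⟨h.1, h.2.trans ⟨fun h S hS S' hS' hcard => h hS hS' (by simp [hcard]),
    fun h S hS S' hS' hcard => h hS hS' ?_⟩⟩
  have h1 := (mem_avoidSets.1 (Finset.mem_coe.1 hS)).1.card_ge hC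
  have h2 := (mem_avoidSets.1 (Finset.mem_coe.1 hS')).1.card_ge hC
  simp only at hcard
  omega

/-- An avoiding set other than `C` contains a second vertex joined to all of `C`, and conversely
such a vertex gives one. -/
lemma isEndClique_iff_card_avoidSets (hC : T.IsNClique k C) (hT : Grown k T C Finset.univ)
    (hu : u ∉ C) (hadj : ∀ c ∈ C, T.Adj u c) :
    IsEndClique k T C ↔ (avoidSets k T C u).card = 1 := by
  have hQ : insert u C ∈ {Q : Finset V | T.IsNClique (k + 1) Q ∧ C ⊆ Q} :=
    ⟨hC.insert hadj, Finset.subset_insert _ _⟩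
  rw [IsEndClique, cliqueDegree, Set.ncard_eq_one, Finset.card_eq_one]
  simp only [hC, true_and]
  constructor
  · rintro ⟨Q, hQeq⟩
    refine ⟨C, Finset.eq_singleton_iff_unique_mem.2 ⟨self_mem_avoidSets hu, fun S hS => ?_⟩⟩
    rw [mem_avoidSets] at hS
    by_contra hne
    obtain ⟨y, hyS, hyC, hy⟩ := hS.1.exists_first hC hne
    have hy' : insert y C ∈ {Q : Finset V | T.IsNClique (k + 1) Q ∧ C ⊆ Q} :=
      ⟨hC.insert hy, Finset.subset_insert _ _⟩
    rw [hQeq, Set.mem_singleton_iff] at hQ hy'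
    have huy : u ∈ insert y C := by rw [hy', ← hQ]; simp
    exact hS.2 (Finset.insert_subset hyS hS.1.subset huy)
  · rintro ⟨S₀, hS₀⟩
    refine ⟨insert u C, Set.eq_singleton_iff_unique_mem.2 ⟨hQ, ?_⟩⟩
    rintro Q ⟨hQc, hCQ⟩
    obtain ⟨y, hyC, rfl, hy⟩ := exists_insert_of_isNClique_subset hC hQc hCQ
    by_contra hne
    have huy : u ∉ insert y C := by
      intro h
      rcases Finset.mem_insert.1 h with rfl | h
      · exact hne rfl
      · exact hu h
    have h1 := self_mem_avoidSets (k := k) (T := T) hu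
    have h2 : insert y C ∈ avoidSets k T C u :=
      mem_avoidSets.2 ⟨hT.insert_of_adj .refl hC hyC hy, huy⟩
    rw [hS₀, Finset.mem_singleton] at h1 h2
    exact hyC (by rw [h1, ← h2]; simp)

/-- The data of an end clique `C₁` inside the `(k+1)`-clique `insert u C`. -/
structure IsEndFace (k : ℕ) (T : SimpleGraph V) (C : Finset V) (u : V) (C₁ : Finset V) :
    Prop where
  isNClique : T.IsNClique k C₁
  mem : u ∈ C₁
  subset : C₁ ⊆ insert u C
  eq_of_adj : ∀ y, y ∉ C₁ → (∀ c ∈ C₁, T.Adj y c) → insert y C₁ = insert u C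

/-- Growth from `C₁` can only begin by completing `insert u C`; after that, regrowing from `C` or
from `C₁` is equivalent. -/
lemma IsEndFace.grownSets_eq {C₁ : Finset V} (h : IsEndFace k T C u C₁) (hC : T.IsNClique k C)
    (hu : u ∉ C) :
    C₁ ∉ throughSets k T C u ∧ grownSets k T C₁ = insert C₁ (throughSets k T C u) := by
  refine ⟨fun hmem => ?_, ?_⟩
  · have h1 := (mem_throughSets.1 hmem).1.subset
    rw [isNClique_eq_of_subset hC h.isNClique h1] at hu
    exact hu h.mem
  · ext S
    rw [mem_grownSets, Finset.mem_insert, mem_throughSets]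
    constructor
    · intro hS
      by_cases hne : S = C₁
      · exact Or.inl hne
      obtain ⟨y, hyS, hyC, hy⟩ := hS.exists_first h.isNClique hne
      have hQS := Finset.insert_subset hyS hS.subset
      rw [h.eq_of_adj y hyC hy] at hQS
      exact Or.inr ⟨hS.regrow h.isNClique hC ((Finset.subset_insert _ _).trans hQS),
        hQS (Finset.mem_insert_self _ _)⟩
    · rintro (rfl | ⟨hS, huS⟩)
      · exact .refl
      · exact hS.regrow hC h.isNClique (h.subset.trans (Finset.insert_subset huS hS.subset))

lemma grownSets_eq_disjUnion : grownSets k T C =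
    (avoidSets k T C u).disjUnion (throughSets k T C u)
      (Finset.disjoint_left.2 fun _ h1 h2 => (mem_avoidSets.1 h1).2 (mem_throughSets.1 h2).2) := by
  ext S
  simp only [mem_grownSets, Finset.mem_disjUnion, mem_avoidSets, mem_throughSets]
  tauto

lemma IsEndFace.mem_grownSets_of_mem {C₁ S : Finset V} (h : IsEndFace k T C u C₁)
    (hC : T.IsNClique k C) (hu : u ∉ C) (hS : Grown k T C S) (huS : u ∈ S) : Grown k T C₁ S := by
  rw [← mem_grownSets, (h.grownSets_eq hC hu).2]
  exact Finset.mem_insert_of_mem (mem_throughSets.2 ⟨hS, huS⟩)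

/-- If `insert u C` is the only member of `branchSets`, all neighbours of `u` lie in `C`. -/
lemma IsBranch.mem_of_adj {U : Finset V} (hT : Grown k T C Finset.univ) (hC : T.IsNClique k C)
    (hu : u ∉ C) (hadj : ∀ c ∈ C, T.Adj u c) (hU : IsBranch T C u U)
    (hc : (branchSets k T C u U).card = 1) : ∀ x, T.Adj u x → x ∈ C := by
  intro x hx
  -- The largest branch set is all of `C ∪ U`; uniqueness makes it equal to the smallest, `insert u
  -- C`.
  have h1 : Finset.univ.filter (fun x => x ∈ C ∨ x ∈ U) ∈ branchSets k T C u U := by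
    rw [mem_branchSets]
    refine ⟨⟨hT.restrict (fun x => x ∈ U) fun x hx _ y hy hyC => hU.not_adj x hx y hy hyC,
      by simp [hU.mem]⟩, by simp⟩
  have h2 := insert_mem_branchSets hT hC hu hadj hU
  obtain ⟨S, hS⟩ := Finset.card_eq_one.1 hc
  rw [hS, Finset.mem_singleton] at h1 h2
  by_contra hxC
  have hxU : x ∈ U := by
    by_contra hxU
    exact hU.not_adj u hU.mem x hxU hxC hx
  have : x ∈ insert u C := by rw [h2, ← h1]; simp [hxU]
  rcases Finset.mem_insert.1 this with rfl | h
  · exact hx.ne rfl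
  · exact hxC h

/-- Both sides say that orders are distinct among the sets grown from `C₁`. A one-element branch
makes `u` a leaf, and then erasing `u` turns the sets through `u` into avoiding sets. -/
lemma IsEndFace.equality_iff {C₁ U : Finset V} (h : IsEndFace k T C u C₁)
    (hT : Grown k T C Finset.univ) (hC : T.IsNClique k C) (hu : u ∉ C)
    (hadj : ∀ c ∈ C, T.Adj u c) (hU : IsBranch T C u U) (ha : (avoidSets k T C u).card ≠ 1) :
    ((branchSets k T C u U).card = 1 ∧
      Set.InjOn Finset.card (avoidSets k T C u : Set (Finset V))) ↔
      PathGrown k T Finset.univ ∧ ∃ v ∈ C₁, IsKLeaf k T v := by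
  have hT₁ : Grown k T C₁ Finset.univ := hT.regrow hC h.isNClique (Finset.subset_univ _)
  constructor
  · rintro ⟨hc, hinj⟩
    have hleaf := hU.mem_of_adj hT hC hu hadj hc
    refine ⟨hT₁.pathGrown h.isNClique ?_, u, h.mem, ?_⟩
    · intro S hS S' hS' hcard
      have hS : S ∈ grownSets k T C₁ := mem_grownSets.2 hS
      have hS' : S' ∈ grownSets k T C₁ := mem_grownSets.2 hS'
      have hmin : ∀ S S' : Finset V, S' ∈ grownSets k T C₁ → S.card = S'.card → S = C₁ →
          S = S' := by
        rintro S S' hS' hcard rfl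
        exact Finset.eq_of_subset_of_card_le (mem_grownSets.1 hS').subset hcard.ge
      by_cases h1 : S = C₁
      · exact hmin S S' hS' hcard h1
      by_cases h2 : S' = C₁
      · exact (hmin S' S hS hcard.symm h2).symm
      have herase : ∀ S ∈ grownSets k T C₁, S ≠ C₁ → u ∈ S ∧ S.erase u ∈ avoidSets k T C u := by
        intro S hS hne
        rw [(h.grownSets_eq hC hu).2, Finset.mem_insert] at hS
        have hS := mem_throughSets.1 (hS.resolve_left hne)
        exact ⟨hS.2, mem_avoidSets.2 ⟨hS.1.erase hu fun x _ hx => hleaf x hx, by simp⟩⟩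
      obtain ⟨huS, hE⟩ := herase S hS h1
      obtain ⟨huS', hE'⟩ := herase S' hS' h2
      have := hinj hE hE' (by
        rw [Finset.card_erase_of_mem huS, Finset.card_erase_of_mem huS', hcard])
      rw [← Finset.insert_erase huS, this, Finset.insert_erase huS']
    · rw [isKLeaf_iff_card_nbrIn, ← hC.card_eq]
      congr 1
      ext x
      simp only [mem_nbrIn, Finset.mem_univ, true_and]
      exact ⟨hleaf x, hadj x⟩
  · rintro ⟨hP, z, hz, hzleaf⟩
    have hinj : Set.InjOn Finset.card {X | Grown k T C₁ X} := by
      have := hP.injOn_card h.isNClique (Finset.subset_univ _) hz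
        (isKLeaf_iff_card_nbrIn.1 hzleaf)
      simpa using this
    constructor
    -- As `a ≠ 1`, another branch with root `y` exists. A second branch set at `u` would give a set
    -- of order `k + 2` inside the branch of `u`, competing with `insert y (insert u C)`.
    · obtain ⟨y, hyu, hyC, hy⟩ : ∃ y, y ≠ u ∧ y ∉ C ∧ ∀ c ∈ C, T.Adj y c := by
        by_contra! hcon
        refine ha (Finset.card_eq_one.2 ⟨C, Finset.eq_singleton_iff_unique_mem.2
          ⟨self_mem_avoidSets hu, fun S hS => ?_⟩⟩)
        rw [mem_avoidSets] at hS
        by_contra hne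
        obtain ⟨y, hyS, hyC, hy⟩ := hS.1.exists_first hC hne
        obtain ⟨c, hc, hyc⟩ := hcon y (by rintro rfl; exact hS.2 hyS) hyC
        exact hyc (hy c hc)
      refine Finset.card_eq_one.2 ⟨insert u C, Finset.eq_singleton_iff_unique_mem.2
          ⟨insert_mem_branchSets hT hC hu hadj hU, fun S hS => ?_⟩⟩
      have hSc := card_add_one_le_of_mem_branchSets hC hu hS
      rw [mem_branchSets] at hS
      have hQS : insert u C ⊆ S := Finset.insert_subset hS.1.2 hS.1.1.subset
      by_contra hne
      have hQc : (insert u C).card = k + 1 := by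
        rw [Finset.card_insert_of_notMem hu, hC.card_eq]
      have hlt := Finset.card_lt_card (Finset.ssubset_iff_subset_ne.2 ⟨hQS, Ne.symm hne⟩)
      obtain ⟨X, hXS, hX, hXc⟩ := (h.mem_grownSets_of_mem hC hu hS.1.1 hS.1.2).exists_card_eq
        h.isNClique (i := k + 2) (by omega) (by omega)
      have hyQ : y ∉ insert u C := by simp [hyu, hyC]
      have hY : Grown k T C₁ (insert y (insert u C)) :=
        h.mem_grownSets_of_mem hC hu
          (hT.insert_of_adj (hT.insert_of_adj .refl hC hu hadj) hC hyQ hy) (by simp)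
      have hXY := hinj hX hY (by rw [hXc, Finset.card_insert_of_notMem hyQ, hQc])
      have hyS : y ∈ S := hXS (hXY ▸ Finset.mem_insert_self _ _)
      exact hyu (hU.eq_of_adj y ((hS.2 y hyS).resolve_left hyC) hy)
    · intro S hS S' hS' hcard
      have hS := mem_avoidSets.1 (Finset.mem_coe.1 hS)
      have hS' := mem_avoidSets.1 (Finset.mem_coe.1 hS')
      have := hinj
        (h.mem_grownSets_of_mem hC hu (hT.insert_of_adj hS.1 hC hS.2 hadj) (by simp))
        (h.mem_grownSets_of_mem hC hu (hT.insert_of_adj hS'.1 hC hS'.2 hadj) (by simp))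
        (by rw [Finset.card_insert_of_notMem hS.2, Finset.card_insert_of_notMem hS'.2, hcard])
      rw [← Finset.erase_insert hS.2, this, Finset.erase_insert hS'.2]

omit [Fintype V] in
lemma exists_isEndFace {C₁ C₂ : Finset V} (hC₁ : IsEndClique k T C₁)
    (hadj : AdjacentCliques k T C₁ C₂) :
    ∃ u, u ∉ C₂ ∧ (∀ c ∈ C₂, T.Adj u c) ∧ IsEndFace k T C₂ u C₁ := by
  obtain ⟨h1, h2, hne, Q, hQ, hQ1, hQ2⟩ := hadj
  obtain ⟨u, hu, rfl, hadju⟩ := exists_insert_of_isNClique_subset h2 hQ hQ2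
  refine ⟨u, hu, hadju, h1, ?_, hQ1, fun y _ hy => ?_⟩
  · by_contra hu1
    exact hne (isNClique_eq_of_subset h1 h2
      fun x hx => (Finset.mem_insert.1 (hQ1 hx)).resolve_left (by rintro rfl; exact hu1 hx))
  · obtain ⟨R, hR⟩ := Set.ncard_eq_one.1 hC₁.2
    have hm1 : insert u C₂ ∈ {Q : Finset V | T.IsNClique (k + 1) Q ∧ C₁ ⊆ Q} := ⟨hQ, hQ1⟩
    have hm2 : insert y C₁ ∈ {Q : Finset V | T.IsNClique (k + 1) Q ∧ C₁ ⊆ Q} :=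
      ⟨h1.insert hy, Finset.subset_insert _ _⟩
    rw [hR, Set.mem_singleton_iff] at hm1 hm2
    rw [hm1, hm2]

end Comparison

end KTree

theorem mainTheorem7 {V : Type u} [Finite V] (k : ℕ) (hk : 1 ≤ k) (T : SimpleGraph V)
    (hT : KTree.IsKTree k T) (C₁ C₂ : Finset V) (hC₁ : KTree.IsEndClique k T C₁)
    (hadj : KTree.AdjacentCliques k T C₁ C₂) :
    KTree.cliqueMeanOrder k T C₁ ≥ KTree.cliqueMeanOrder k T C₂ ∧
    (KTree.cliqueMeanOrder k T C₁ = KTree.cliqueMeanOrder k T C₂ ↔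
      KTree.IsEndClique k T C₂ ∨
        (KTree.IsPathTypeKTree k T ∧ ∃ v ∈ C₁, KTree.IsKLeaf k T v)) := by
  classical
  have := Fintype.ofFinite V
  have hC₂ := hadj.2.1
  obtain ⟨u, hu, hadju, hface⟩ := KTree.exists_isEndFace hC₁ hadj
  have hG := hT.grown_univ hC₂
  obtain ⟨U, hU⟩ := hG.exists_isBranch hC₂ hu hadju
  have ha : 1 ≤ (KTree.avoidSets k T C₂ u).card :=
    Finset.card_pos.2 ⟨C₂, KTree.self_mem_avoidSets hu⟩
  have hc : 1 ≤ (KTree.branchSets k T C₂ u U).card :=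
    Finset.card_pos.2 ⟨_, KTree.insert_mem_branchSets hG hC₂ hu hadju hU⟩
  obtain ⟨hs, hseq⟩ := KTree.two_mul_sum_avoidSets_le (u := u) hC₂
  have hcmp := KTree.div_comparison ha hc (KTree.card_branchSets_le_sum hC₂ hu) hs
  obtain ⟨hnot, hins⟩ := hface.grownSets_eq hC₂ hu
  -- The extra set `C₁` has offset `0`: it raises the count by one but adds nothing to the sum.
  rw [KTree.cliqueMeanOrder_eq hT hC₁.1, KTree.cliqueMeanOrder_eq hT hC₂, hins,
    Finset.sum_insert hnot, Finset.card_insert_of_notMem hnot,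
    KTree.grownSets_eq_disjUnion (u := u), Finset.sum_disjUnion, Finset.card_disjUnion,
    hU.card_throughSets hC₂ hu, hU.sum_card_throughSets hC₂ hu, hC₁.1.card_eq, Nat.sub_self,
    zero_add, add_comm _ 1, add_right_inj, hcmp.2]
  refine ⟨by linarith [hcmp.1], ?_⟩
  rw [KTree.isEndClique_iff_card_avoidSets hC₂ hG hu hadju,
    KTree.isPathTypeKTree_iff_pathGrown]
  by_cases ha1 : (KTree.avoidSets k T C₂ u).card = 1
  · simp only [ha1, true_or]
  · simp only [ha1, false_or]
    rw [← hface.equality_iff hG hC₂ hu hadju hU ha1, hseq]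
    -- The condition `t = 1` follows from `c = 1`: the only branch set is then `insert u C₂`, of
    -- offset `1`.
    refine ⟨fun h => ⟨h.1, h.2.2⟩, fun h => ⟨h.1, ?_, h.2⟩⟩
    obtain ⟨S, hS⟩ := Finset.card_eq_one.1 h.1
    have hm := KTree.insert_mem_branchSets hG hC₂ hu hadju hU
    rw [hS, Finset.mem_singleton] at hm
    rw [hS, Finset.sum_singleton, ← hm, Finset.card_insert_of_notMem hu, hC₂.card_eq]
    omega
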